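/- Let $N\ge 2$, let $\ell_1,\dots,\ell_N\in(0,\infty]$ and $\omega_1,\dots,\omega_N\in\mathbb R$, and let $\mathcal H=\bigoplus_{j=1}^N L^2(0,\ell_j)$ be the state space of the star graph whose links $(0,\ell_j)$ are joined at the vertex $x=0$. For real-valued potentials $U=(U_1,\dots,U_N)$ which are integrable on all bounded subintervals of the links (up to the endpoint $0$, and up to $\ell_j$ if $\ell_j<\infty$), and for $\alpha\in\mathbb R$, let $H_\alpha(U)$ be the operator $\{\psi_j\}\mapsto\{-\psi_j''+U_j\psi_j\}$ in $\mathcal H$ whose domain consists of all $\{\psi_j\}\in\mathcal H$ such that $\psi_j,\psi_j'$ are locally absolutely continuous on the link including its finite endpoints, $\{-\psi_j''+U_j\psi_j\}\in\mathcal H$, $$\psi_1(0+)=\dots=\psi_N(0+)=:\psi(0),\qquad \sum_{j=1}^N\psi_j'(0+)=\alpha\,\psi(0),$$ and $\psi_j(\ell_j)\cos\omega_j+\psi_j'(\ell_j)\sin\omega_j=0$ for every $j$ with $\ell_j<\infty$. Theorem. Let $V_1,\dots,V_N$ be real-valued potentials on the links which are integrable on all bounded subintervals as above and (essentially) bounded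 below, and let $W_j\in L^1(0,\ell_j)$ be real-valued, $j=1,\dots,N$. Put $W_{\varepsilon,j}(x)=\varepsilon^{-1}W_j(x/\varepsilon)$ for $\varepsilon>0$, where $W_j$ is extended by $0$ outside $(0,\ell_j)$, and $$\alpha=\sum_{j=1}^N\int_0^{\ell_j}W_j(x)\,dx .$$ Then $H_0(V+W_\varepsilon)\to H_\alpha(V)$ in the norm resolvent sense as $\varepsilon\to0+$; that is, $H_\alpha(V)$ is self-adjoint, $H_0(V+W_\varepsilon)$ is self-adjoint for all sufficiently small $\varepsilon>0$, and for every $z\in\mathbb C\setminus\mathbb R$ $$\bigl\|(H_0(V+W_\varepsilon)-z)^{-1}-(H_\alpha(V)-z)^{-1}\bigr\|\to0\qquad(\varepsilon\to0+).$$ -/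

import Mathlib

open MeasureTheory Set Filter Topology

namespace StarGraph

noncomputable section

/-- The open link `(0, ℓ)`, where `ℓ` may be `∞` (written `⊤`). -/
def link (ℓ : EReal) : Set ℝ := {x | 0 < x ∧ (x : EReal) < ℓ}

/-- The link with its (finite) endpoints: `[0, ℓ]` if `ℓ < ∞`, and `[0, ∞)` if `ℓ = ∞`. -/
def closedLink (ℓ : EReal) : Set ℝ := {x | 0 ≤ x ∧ (x : EReal) ≤ ℓ}

/-- Lebesgue measure on the link `(0, ℓ)`. -/
abbrev linkMeasure (ℓ : EReal) : Measure ℝ := volume.restrict (link ℓ)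

/-- The state space `⨁ⱼ L²(0, ℓⱼ)` (complex-valued functions, Hilbert space direct sum). -/
abbrev StateSpace {N : ℕ} (ℓ : Fin N → EReal) : Type :=
  PiLp 2 (fun j : Fin N => Lp ℂ 2 (linkMeasure (ℓ j)))

/-- `F` is locally absolutely continuous on the link with its endpoints, and `p` is its derivative
(defined almost everywhere, and integrable on bounded subintervals). -/
def HasLocACDeriv (ℓ : EReal) (F p : ℝ → ℂ) : Prop :=
  ∀ x ∈ closedLink ℓ, IntervalIntegrable p volume 0 x ∧ F x = F 0 + ∫ t in (0 : ℝ)..x, p t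

theorem HasLocACDeriv.zero (ℓ : EReal) : HasLocACDeriv ℓ 0 0 := by
  intro x _
  exact ⟨(intervalIntegrable_const : IntervalIntegrable (fun _ => (0 : ℂ)) volume 0 x), by simp⟩

theorem HasLocACDeriv.add {ℓ : EReal} {F p G q : ℝ → ℂ} (hF : HasLocACDeriv ℓ F p)
    (hG : HasLocACDeriv ℓ G q) : HasLocACDeriv ℓ (F + G) (p + q) := by
  intro x hx
  obtain ⟨h1, h2⟩ := hF x hx
  obtain ⟨h3, h4⟩ := hG x hx
  refine ⟨h1.add h3, ?_⟩
  simp only [Pi.add_apply]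
  rw [intervalIntegral.integral_add h1 h3, h2, h4]
  ring

theorem HasLocACDeriv.smul {ℓ : EReal} {F p : ℝ → ℂ} (c : ℂ) (hF : HasLocACDeriv ℓ F p) :
    HasLocACDeriv ℓ (c • F) (c • p) := by
  intro x hx
  obtain ⟨h1, h2⟩ := hF x hx
  refine ⟨h1.smul c, ?_⟩
  simp only [Pi.smul_apply]
  rw [intervalIntegral.integral_smul, h2, smul_add]

theorem HasLocACDeriv.ae_deriv_eq_zero {ℓ : EReal} {F p : ℝ → ℂ} (hF : HasLocACDeriv ℓ F p)
    (h0 : F =ᵐ[linkMeasure ℓ] 0) : p =ᵐ[linkMeasure ℓ] 0 := by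
  have key : ∀ b ∈ link ℓ, ∀ᵐ x, x ∈ Ioo 0 b → p x = 0 := by
    intro b hb
    have hsub : Icc 0 b ⊆ closedLink ℓ := fun x hx =>
      ⟨hx.1, (EReal.coe_le_coe_iff.2 hx.2).trans hb.2.le⟩
    have hsub' : Ioo 0 b ⊆ link ℓ := fun x hx =>
      ⟨hx.1, (EReal.coe_lt_coe_iff.2 hx.2).trans hb.2⟩
    have hp : IntervalIntegrable p volume 0 b := (hF b (hsub ⟨hb.1.le, le_rfl⟩)).1
    have hcont : ContinuousOn F (Icc 0 b) := by
      have h1 : ContinuousOn (fun x => F 0 + ∫ t in (0 : ℝ)..x, p t) (Icc 0 b) := by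
        have := intervalIntegral.continuousOn_primitive_interval' hp left_mem_uIcc
        rw [uIcc_of_le hb.1.le] at this
        exact continuousOn_const.add this
      exact h1.congr fun x hx => (hF x (hsub hx)).2
    have hz : EqOn F 0 (Ioo 0 b) := by
      refine Measure.eqOn_open_of_ae_eq (μ := volume) ?_ isOpen_Ioo
        (hcont.mono Ioo_subset_Icc_self) continuousOn_const
      exact ae_restrict_of_ae_restrict_of_subset hsub' h0
    filter_upwards [hp.ae_hasDerivAt_integral] with x hx hxb
    have hx' := hx (by rw [uIcc_of_le hb.1.le]; exact Ioo_subset_Icc_self hxb) 0 left_mem_uIcc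
    have hconst : (fun u => ∫ t in (0 : ℝ)..u, p t) =ᶠ[𝓝 x] fun _ => - F 0 := by
      filter_upwards [isOpen_Ioo.mem_nhds hxb] with u hu
      have h1 := (hF u (hsub (Ioo_subset_Icc_self hu))).2
      rw [hz hu] at h1
      exact (neg_eq_of_add_eq_zero_right h1.symm).symm
    exact (hx'.congr_of_eventuallyEq hconst.symm).unique (hasDerivAt_const x (- F 0))
  have hall : ∀ᵐ x, ∀ q : ℚ, (q : ℝ) ∈ link ℓ → x ∈ Ioo 0 (q : ℝ) → p x = 0 := by
    rw [ae_all_iff]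
    intro q
    by_cases hq : (q : ℝ) ∈ link ℓ
    · filter_upwards [key q hq] with x hx _ using hx
    · exact Eventually.of_forall fun x h => absurd h hq
  refine (ae_restrict_of_ae hall).mp ?_
  have hmeas : MeasurableSet (link ℓ) :=
    (isOpen_lt continuous_const continuous_id).measurableSet.inter
      (isOpen_lt continuous_coe_real_ereal continuous_const).measurableSet
  filter_upwards [ae_restrict_mem hmeas] with x hx hq
  obtain ⟨q, hq1, hq2⟩ := EReal.lt_iff_exists_rat_btwn.1 hx.2
  have hq1' : x < (q : ℝ) := by exact_mod_cast hq1
  exact hq q ⟨hx.1.trans hq1', hq2⟩ ⟨hx.1, hq1'⟩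

/-- The graph of the Schrödinger operator `H_α(V)` with `δ` coupling `α` at the vertex: the pairs
`(ψ, φ)` of states such that `ψⱼ, ψⱼ'` are locally absolutely continuous on each link (up to its
endpoints), `φⱼ = -ψⱼ'' + Vⱼ ψⱼ`,

* at the vertex, `ψ₁(0) = ⋯ = ψ_N(0) =: c` and `∑ⱼ ψⱼ'(0) = α c`;
* at the end of each link of finite length `b = ℓⱼ`,
  `ψⱼ(b) cos ωⱼ + ψⱼ'(b) sin ωⱼ = 0`.

Here `f j`, `f' j`, `f'' j` are (representatives of) `ψⱼ`, `ψⱼ'`, `ψⱼ''`. The requirements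
`ψ ∈ ⨁ L²` and `{-ψⱼ'' + Vⱼ ψⱼ} ∈ ⨁ L²` are contained in the types of `ψ` and `φ`. -/
def hamiltonianGraph {N : ℕ} (ℓ : Fin N → EReal) (ω : Fin N → ℝ) (α : ℝ) (V : Fin N → ℝ → ℝ) :
    Submodule ℂ (StateSpace ℓ × StateSpace ℓ) where
  carrier := {P | ∃ f f' f'' : Fin N → ℝ → ℂ,
    (∀ j, P.1 j =ᵐ[linkMeasure (ℓ j)] f j) ∧
    (∀ j, HasLocACDeriv (ℓ j) (f j) (f' j)) ∧
    (∀ j, HasLocACDeriv (ℓ j) (f' j) (f'' j)) ∧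
    (∀ j, P.2 j =ᵐ[linkMeasure (ℓ j)] fun x => - f'' j x + (V j x : ℂ) * f j x) ∧
    (∃ c : ℂ, (∀ j, f j 0 = c) ∧ ∑ j, f' j 0 = (α : ℂ) * c) ∧
    (∀ j, ∀ b : ℝ, ℓ j = (b : EReal) →
      f j b * (Real.cos (ω j) : ℂ) + f' j b * (Real.sin (ω j) : ℂ) = 0)}
  zero_mem' := by
    refine ⟨0, 0, 0, fun j => ?_, fun j => HasLocACDeriv.zero _, fun j => HasLocACDeriv.zero _,
      fun j => ?_, ⟨0, fun j => rfl, by simp⟩, fun j b _ => by simp⟩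
    · exact Lp.coeFn_zero _ _ _
    · filter_upwards [Lp.coeFn_zero ℂ 2 (linkMeasure (ℓ j))] with x hx
      simpa using hx
  add_mem' := by
    rintro P Q ⟨f, f', f'', h1, h2, h3, h4, ⟨c, h5, h6⟩, h7⟩
      ⟨g, g', g'', k1, k2, k3, k4, ⟨d, k5, k6⟩, k7⟩
    refine ⟨f + g, f' + g', f'' + g'', fun j => ?_, fun j => (h2 j).add (k2 j),
      fun j => (h3 j).add (k3 j), fun j => ?_, ⟨c + d, fun j => ?_, ?_⟩, fun j b hb => ?_⟩
    · filter_upwards [h1 j, k1 j, Lp.coeFn_add (P.1 j) (Q.1 j)] with x a1 a2 a3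
      rw [Prod.fst_add, PiLp.add_apply, a3]
      simp [a1, a2]
    · filter_upwards [h4 j, k4 j, Lp.coeFn_add (P.2 j) (Q.2 j)] with x a1 a2 a3
      rw [Prod.snd_add, PiLp.add_apply, a3]
      simp only [Pi.add_apply, a1, a2]
      ring
    · simp [h5, k5]
    · simp [Finset.sum_add_distrib, h6, k6, mul_add]
    · have e1 := h7 j b hb
      have e2 := k7 j b hb
      simp only [Pi.add_apply]
      linear_combination e1 + e2
  smul_mem' := by
    rintro a P ⟨f, f', f'', h1, h2, h3, h4, ⟨c, h5, h6⟩, h7⟩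
    refine ⟨a • f, a • f', a • f'', fun j => ?_, fun j => (h2 j).smul a,
      fun j => (h3 j).smul a, fun j => ?_, ⟨a * c, fun j => ?_, ?_⟩, fun j b hb => ?_⟩
    · filter_upwards [h1 j, Lp.coeFn_smul a (P.1 j)] with x a1 a3
      rw [Prod.smul_fst, PiLp.smul_apply, a3]
      simp [a1]
    · filter_upwards [h4 j, Lp.coeFn_smul a (P.2 j)] with x a1 a3
      rw [Prod.smul_snd, PiLp.smul_apply, a3]
      simp only [Pi.smul_apply, a1, smul_eq_mul]
      ring
    · simp [h5]
    · simp only [Pi.smul_apply, smul_eq_mul, ← Finset.mul_sum, h6]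
      ring
    · have e1 := h7 j b hb
      simp only [Pi.smul_apply, smul_eq_mul]
      linear_combination a * e1

theorem hamiltonianGraph_snd_eq_zero {N : ℕ} (ℓ : Fin N → EReal) (ω : Fin N → ℝ) (α : ℝ)
    (V : Fin N → ℝ → ℝ) (P : StateSpace ℓ × StateSpace ℓ) (hP : P ∈ hamiltonianGraph ℓ ω α V)
    (h0 : P.1 = 0) : P.2 = 0 := by
  obtain ⟨f, f', f'', h1, h2, h3, h4, -, -⟩ := hP
  ext j : 1
  refine Lp.ext ?_
  have e0 : f j =ᵐ[linkMeasure (ℓ j)] 0 := by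
    filter_upwards [h1 j, Lp.coeFn_zero ℂ 2 (linkMeasure (ℓ j))] with x a1 a2
    rw [← a1, h0]
    exact a2
  have e1 := (h2 j).ae_deriv_eq_zero e0
  have e2 := (h3 j).ae_deriv_eq_zero e1
  filter_upwards [h4 j, e0, e2, Lp.coeFn_zero ℂ 2 (linkMeasure (ℓ j))] with x a1 a2 a3 a4
  rw [a1, a2, a3]
  simpa using a4.symm

/-- The Schrödinger operator `H_α(V) {ψⱼ} = {-ψⱼ'' + Vⱼ ψⱼ}` on the star graph with links of lengths
`ℓⱼ`, with `δ` coupling `α` at the vertex and the boundary conditions given by `ωⱼ` at the ends of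
the finite links, as an unbounded operator. Its graph is `hamiltonianGraph`, see
`graph_hamiltonian`. -/
def hamiltonian {N : ℕ} (ℓ : Fin N → EReal) (ω : Fin N → ℝ) (α : ℝ) (V : Fin N → ℝ → ℝ) :
    StateSpace ℓ →ₗ.[ℂ] StateSpace ℓ :=
  (hamiltonianGraph ℓ ω α V).toLinearPMap

theorem graph_hamiltonian {N : ℕ} (ℓ : Fin N → EReal) (ω : Fin N → ℝ) (α : ℝ)
    (V : Fin N → ℝ → ℝ) : (hamiltonian ℓ ω α V).graph = hamiltonianGraph ℓ ω α V :=
  Submodule.toLinearPMap_graph_eq _ (hamiltonianGraph_snd_eq_zero ℓ ω α V)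

/-- The squeezed potential `W_ε(x) = ε⁻¹ W(x/ε)`, where a potential `W` on `(0, ℓ)` is understood
to vanish outside `(0, ℓ)`. -/
def squeezed (ℓ : EReal) (ε : ℝ) (W : ℝ → ℝ) : ℝ → ℝ :=
  fun x => ε⁻¹ * (link ℓ).indicator W (x / ε)

section Resolvent

variable {E : Type*} [NormedAddCommGroup E] [InnerProductSpace ℂ E] [CompleteSpace E]

/-- The bounded everywhere defined operator `R` is the resolvent `(A - z)⁻¹`. -/
def IsResolventAt (A : E →ₗ.[ℂ] E) (z : ℂ) (R : E →L[ℂ] E) : Prop :=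
  (∀ y : E, ∃ x : A.domain, (x : E) = R y ∧ A x - z • (x : E) = y) ∧
    ∀ x : A.domain, R (A x - z • (x : E)) = x

/-- Norm resolvent convergence, along a filter `l`, of self-adjoint operators `A i` to a self-adjoint
operator `B`: for every non-real `z`, the resolvents `(A i - z)⁻¹` converge to `(B - z)⁻¹` in the
operator norm. -/
def NormResolventTendsto {ι : Type*} (A : ι → E →ₗ.[ℂ] E) (l : Filter ι) (B : E →ₗ.[ℂ] E) :
    Prop :=
  (∀ᶠ i in l, IsSelfAdjoint (A i)) ∧ IsSelfAdjoint B ∧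
    ∀ z : ℂ, z.im ≠ 0 → ∃ (R : ι → E →L[ℂ] E) (S : E →L[ℂ] E),
      (∀ᶠ i in l, IsResolventAt (A i) z (R i)) ∧ IsResolventAt B z S ∧
        Tendsto (fun i => ‖R i - S‖) l (𝓝 0)

end Resolvent

end

end StarGraph

namespace StarGraph

noncomputable section

/-! The form domain of `-ψ'' + V ψ` on the star graph is a Hilbert space `Q` for the energy inner
product of `-ψ'' + (V - m + s²) ψ`. Point evaluations are bounded functionals on `Q` whose norms
tend to `0` as `s → ∞`, so an integrable potential, the `δ` coupling and the end terms are
represented by a bounded operator `T` on `Q`, of norm less than `1` for large `s` and uniformly in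
`ε`. With `J` the inclusion of `Q` into the state space, the resolvent at the real point `m - s²` is
`J (1 + T)⁻¹ J*`, which is norm continuous in `T`. The evaluation at `x` depends norm continuously
on `x`, so in the representing operators the potential `W_ε` converges to `∫ W` times the squared
evaluation at the vertex. Norm convergence of the resolvents at one real point then gives it at
every non-real point.

That `J (1 + T)⁻¹ J*` is the resolvent of the operator with its maximal domain needs the
uniqueness of square integrable solutions on infinite links, which a cutoff argument reduces to
functions in `Q`. -/

section NormedRing

variable {A : Type*} [NormedRing A] [HasSummableGeomSeries A]

theorem isUnit_one_add_of_norm_lt_one {a : A} (ha : ‖a‖ < 1) : IsUnit (1 + a) := by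
  simpa using isUnit_one_sub_of_norm_lt_one (x := -a) (by rwa [norm_neg])

theorem tendsto_ringInverse {ι : Type*} {l : Filter ι} {f : ι → A} {a : A} (ha : IsUnit a)
    (h : Tendsto f l (𝓝 a)) : Tendsto (fun i => Ring.inverse (f i)) l (𝓝 (Ring.inverse a)) := by
  obtain ⟨u, rfl⟩ := ha
  exact (NormedRing.inverse_continuousAt u).tendsto.comp h

end NormedRing

section Resolvent

open scoped InnerProductSpace

variable {E : Type*} [NormedAddCommGroup E] [InnerProductSpace ℂ E]

/- `A - z = (1 - (z - w) R) (A - w)` for `R = (A - w)⁻¹`. -/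
theorem IsResolventAt.mul_inverse {A : E →ₗ.[ℂ] E} {w z : ℂ} {R : E →L[ℂ] E}
    (h : IsResolventAt A w R) (hu : IsUnit (1 - (z - w) • R)) :
    IsResolventAt A z (R * Ring.inverse (1 - (z - w) • R)) := by
  obtain ⟨h_right, h_left⟩ := h
  have h_factor : ∀ x : A.domain,
      A x - z • (x : E) = (1 - (z - w) • R) (A x - w • (x : E)) := fun x => by
    simp only [sub_apply, one_apply_eq_self, smul_apply, h_left x, sub_smul]
    abel
  refine ⟨fun y => ?_, fun x => ?_⟩
  · obtain ⟨x, hx, hxy⟩ := h_right (Ring.inverse (1 - (z - w) • R) y)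
    refine ⟨x, hx, ?_⟩
    rw [h_factor, hxy, ← mul_apply_eq_comp, Ring.mul_inverse_cancel _ hu, one_apply_eq_self]
  · rw [h_factor, mul_apply_eq_comp, ← mul_apply_eq_comp (Ring.inverse _),
      Ring.inverse_mul_cancel _ hu, one_apply_eq_self, h_left]

variable [CompleteSpace E]

theorem IsResolventAt.dense_domain {A : E →ₗ.[ℂ] E} {z : ℂ} {R : E →L[ℂ] E}
    (hR : IsSelfAdjoint R) (h : IsResolventAt A z R) : Dense (A.domain : Set E) := by
  rw [Submodule.dense_iff_topologicalClosure_eq_top, Submodule.topologicalClosure_eq_top_iff,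
    Submodule.eq_bot_iff]
  intro y hy
  have hRy : R y = 0 := by
    obtain ⟨x, hx, -⟩ := h.1 (R y)
    rw [← inner_self_eq_zero (𝕜 := ℂ), ← hR.isSymmetric.apply_clm, ← hx]
    exact (Submodule.mem_orthogonal _ _).1 hy x x.2
  obtain ⟨x, hx, hxy⟩ := h.1 y
  have hx0 : x = 0 := Subtype.ext (hx.trans hRy)
  rw [← hxy, hx0, A.map_zero, ZeroMemClass.coe_zero, smul_zero, sub_zero]

theorem IsResolventAt.isFormalAdjoint {A : E →ₗ.[ℂ] E} {t : ℝ} {R : E →L[ℂ] E}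
    (hR : IsSelfAdjoint R) (h : IsResolventAt A t R) : A.IsFormalAdjoint A := by
  intro x y
  have h_shifted : ⟪A x - (t : ℂ) • (x : E), (y : E)⟫_ℂ =
      ⟪(x : E), A y - (t : ℂ) • (y : E)⟫_ℂ := by
    conv_lhs => rw [← h.2 y]
    conv_rhs => rw [← h.2 x]
    exact (hR.isSymmetric _ _).symm
  rwa [inner_sub_left, inner_sub_right, inner_smul_left, inner_smul_right, Complex.conj_ofReal,
    sub_left_inj] at h_shifted

theorem IsResolventAt.isSelfAdjoint {A : E →ₗ.[ℂ] E} {t : ℝ} {R : E →L[ℂ] E}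
    (hR : IsSelfAdjoint R) (h : IsResolventAt A t R) : IsSelfAdjoint A := by
  have hdense := h.dense_domain hR
  have hformal := h.isFormalAdjoint hR
  have hle : A ≤ A.adjoint := hformal.le_adjoint hdense
  rw [LinearPMap.isSelfAdjoint_def]
  refine (LinearPMap.eq_of_le_of_domain_eq hle (le_antisymm hle.1 fun w hw => ?_)).symm
  obtain ⟨x, -, hx⟩ := h.1 (A.adjoint ⟨w, hw⟩ - (t : ℂ) • w)
  -- `w - x` is orthogonal to the range of `A - t`, which is the whole space.
  have hwx : w = x := by
    rw [← sub_eq_zero, ← inner_self_eq_zero (𝕜 := ℂ)]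
    obtain ⟨u, -, hu⟩ := h.1 (w - x)
    have hw_adj : ⟪A.adjoint ⟨w, hw⟩, (u : E)⟫_ℂ = ⟪w, A u⟫_ℂ :=
      LinearPMap.adjoint_isFormalAdjoint hdense ⟨w, hw⟩ u
    have hx_adj : ⟪A x, (u : E)⟫_ℂ = ⟪(x : E), A u⟫_ℂ := hformal x u
    have hx_inner := congrArg (fun v => ⟪v, (u : E)⟫_ℂ) hx
    simp only [inner_sub_left, inner_smul_left, Complex.conj_ofReal, hw_adj, hx_adj] at hx_inner
    nth_rewrite 2 [← hu]
    simp only [inner_sub_left, inner_sub_right, inner_smul_right]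
    linear_combination -hx_inner
  rw [hwx]
  exact x.2

theorem isUnit_one_sub_smul_of_isSelfAdjoint {R : E →L[ℂ] E} (hR : IsSelfAdjoint R) {s : ℂ}
    (hs : s.im ≠ 0) : IsUnit (1 - s • R) := by
  have hs0 : s ≠ 0 := by
    rintro rfl
    exact hs rfl
  have hs_inv : s⁻¹ ∉ spectrum ℂ R := fun hmem => by
    have him := hR.im_eq_zero_of_mem_spectrum hmem
    rw [Complex.inv_im, div_eq_zero_iff, neg_eq_zero, Complex.normSq_eq_zero] at him
    exact him.elim hs hs0
  have h_factor : 1 - s • R = s • (algebraMap ℂ (E →L[ℂ] E) s⁻¹ - R) := by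
    rw [smul_sub, Algebra.algebraMap_eq_smul_one, smul_smul, mul_inv_cancel₀ hs0, one_smul]
  rw [h_factor]
  exact (spectrum.notMem_iff.1 hs_inv).smul (Units.mk0 s hs0)

theorem normResolventTendsto_of_tendsto {ι : Type*} {A : ι → E →ₗ.[ℂ] E} {l : Filter ι}
    {B : E →ₗ.[ℂ] E} {t : ℝ} {R : ι → E →L[ℂ] E} {S : E →L[ℂ] E}
    (hR : ∀ᶠ i in l, IsSelfAdjoint (R i)) (hRA : ∀ᶠ i in l, IsResolventAt (A i) t (R i))
    (hS : IsSelfAdjoint S) (hSB : IsResolventAt B t S) (hRS : Tendsto R l (𝓝 S)) :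
    NormResolventTendsto A l B := by
  refine ⟨?_, hSB.isSelfAdjoint hS, fun z hz => ?_⟩
  · filter_upwards [hR, hRA] with i hi hiA using hiA.isSelfAdjoint hi
  have hz' : (z - (t : ℂ)).im ≠ 0 := by simpa using hz
  have hu := isUnit_one_sub_smul_of_isSelfAdjoint hS hz'
  refine ⟨fun i => R i * Ring.inverse (1 - (z - t) • R i),
    S * Ring.inverse (1 - (z - t) • S), ?_, hSB.mul_inverse hu, ?_⟩
  · filter_upwards [hR, hRA] with i hi hiA
    exact hiA.mul_inverse (isUnit_one_sub_smul_of_isSelfAdjoint hi hz')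
  · rw [← tendsto_iff_norm_sub_tendsto_zero]
    exact hRS.mul (tendsto_ringInverse hu (tendsto_const_nhds.sub (hRS.const_smul _)))

variable {Q : Type*} [NormedAddCommGroup Q] [InnerProductSpace ℂ Q] [CompleteSpace Q]

/-- The operator `J (1 + T)⁻¹ J*`. If `J` embeds the form domain `Q` of a positive form `⟪p, q⟫`
into `E`, it is the inverse of the operator associated with the perturbed form
`⟪p, q⟫ + ⟪T p, q⟫`. -/
def formResolvent (J : Q →L[ℂ] E) (T : Q →L[ℂ] Q) : E →L[ℂ] E :=
  J ∘L Ring.inverse (1 + T) ∘L ContinuousLinearMap.adjoint J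

theorem isSelfAdjoint_formResolvent (J : Q →L[ℂ] E) {T : Q →L[ℂ] Q} (hT : IsSelfAdjoint T) :
    IsSelfAdjoint (formResolvent J T) := by
  have h_inv : ContinuousLinearMap.adjoint (Ring.inverse (1 + T)) = Ring.inverse (1 + T) := by
    rw [← ContinuousLinearMap.star_eq_adjoint, ← Ring.inverse_star, star_add, star_one, hT.star_eq]
  rw [ContinuousLinearMap.isSelfAdjoint_iff', formResolvent, ContinuousLinearMap.adjoint_comp,
    ContinuousLinearMap.adjoint_comp, ContinuousLinearMap.adjoint_adjoint, h_inv]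
  rfl

theorem tendsto_formResolvent (J : Q →L[ℂ] E) {ι : Type*} {l : Filter ι} {T : ι → Q →L[ℂ] Q}
    {S : Q →L[ℂ] Q} (hS : ‖S‖ < 1) (h : Tendsto T l (𝓝 S)) :
    Tendsto (fun i => formResolvent J (T i)) l (𝓝 (formResolvent J S)) := by
  have h_inv : Tendsto (fun i => Ring.inverse (1 + T i)) l (𝓝 (Ring.inverse (1 + S))) :=
    tendsto_ringInverse (isUnit_one_add_of_norm_lt_one hS) (tendsto_const_nhds.add h)
  exact (((continuous_id.clm_comp_const _).const_clm_comp J).tendsto _).comp h_inv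

theorem exists_inner_add_inner_eq_inner (J : Q →L[ℂ] E) {T : Q →L[ℂ] Q} (hT : ‖T‖ < 1) (g : E) :
    ∃ p : Q, J p = formResolvent J T g ∧ ∀ q, ⟪p, q⟫_ℂ + ⟪T p, q⟫_ℂ = ⟪g, J q⟫_ℂ := by
  refine ⟨Ring.inverse (1 + T) (ContinuousLinearMap.adjoint J g), rfl, fun q => ?_⟩
  rw [← ContinuousLinearMap.adjoint_inner_left, ← inner_add_left]
  congr 1
  exact congrArg (fun X : Q →L[ℂ] Q => X (ContinuousLinearMap.adjoint J g))
    (Ring.mul_inverse_cancel _ (isUnit_one_add_of_norm_lt_one hT))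

theorem normResolventTendsto_of_formResolvent {ι : Type*} {A : ι → E →ₗ.[ℂ] E} {l : Filter ι}
    {B : E →ₗ.[ℂ] E} {t : ℝ} (J : Q →L[ℂ] E) {T : ι → Q →L[ℂ] Q} {S : Q →L[ℂ] Q}
    (hT : ∀ᶠ i in l, IsSelfAdjoint (T i))
    (hTA : ∀ᶠ i in l, IsResolventAt (A i) t (formResolvent J (T i)))
    (hS : IsSelfAdjoint S) (hSB : IsResolventAt B t (formResolvent J S)) (hS1 : ‖S‖ < 1)
    (hTS : Tendsto T l (𝓝 S)) : NormResolventTendsto A l B :=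
  normResolventTendsto_of_tendsto (hT.mono fun _ => isSelfAdjoint_formResolvent J) hTA
    (isSelfAdjoint_formResolvent J hS) hSB (tendsto_formResolvent J hS1 hTS)

end Resolvent

section Link

variable {ℓ : EReal}

theorem measurableSet_link (ℓ : EReal) : MeasurableSet (link ℓ) :=
  (isOpen_lt continuous_const continuous_id).measurableSet.inter
    (isOpen_lt continuous_coe_real_ereal continuous_const).measurableSet

theorem link_subset_closedLink : link ℓ ⊆ closedLink ℓ := fun _ hx => ⟨hx.1.le, hx.2.le⟩

theorem Icc_subset_closedLink {x : ℝ} (hx : x ∈ closedLink ℓ) : Icc 0 x ⊆ closedLink ℓ :=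
  fun _ ht => ⟨ht.1, (EReal.coe_le_coe_iff.2 ht.2).trans hx.2⟩

theorem Ioo_subset_link {x : ℝ} (hx : x ∈ closedLink ℓ) : Ioo 0 x ⊆ link ℓ :=
  fun _ ht => ⟨ht.1, (EReal.coe_lt_coe_iff.2 ht.2).trans_le hx.2⟩

theorem zero_mem_closedLink (hℓ : 0 < ℓ) : (0 : ℝ) ∈ closedLink ℓ := ⟨le_rfl, hℓ.le⟩

theorem exists_rat_mem_link_gt {x : ℝ} (hx : x ∈ link ℓ) : ∃ q : ℚ, x < q ∧ (q : ℝ) ∈ link ℓ := by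
  obtain ⟨q, hxq, hqℓ⟩ := EReal.lt_iff_exists_rat_btwn.1 hx.2
  have hxq' : x < (q : ℝ) := by exact_mod_cast hxq
  exact ⟨q, hxq', hx.1.trans hxq', hqℓ⟩

theorem ae_linkMeasure_of_ae_Ioo {P : ℝ → Prop}
    (h : ∀ x ∈ link ℓ, ∀ᵐ t, t ∈ Ioo 0 x → P t) : ∀ᵐ t ∂linkMeasure ℓ, P t := by
  have h_rat : ∀ᵐ t, ∀ q : ℚ, (q : ℝ) ∈ link ℓ → t ∈ Ioo 0 (q : ℝ) → P t :=
    ae_all_iff.2 fun q => by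
      by_cases hq : (q : ℝ) ∈ link ℓ
      · filter_upwards [h q hq] with t ht _ using ht
      · exact Eventually.of_forall fun t hq' => absurd hq' hq
  filter_upwards [ae_restrict_mem (measurableSet_link ℓ), ae_restrict_of_ae h_rat] with t ht hP
  obtain ⟨q, htq, hq⟩ := exists_rat_mem_link_gt ht
  exact hP q hq ⟨ht.1, htq⟩

theorem restrict_linkMeasure_Ioc {x y : ℝ} (hx : 0 ≤ x) (hy : y ∈ closedLink ℓ) :
    (linkMeasure ℓ).restrict (Ioc x y) = volume.restrict (Ioc x y) := by
  rw [linkMeasure, Measure.restrict_restrict measurableSet_Ioc]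
  refine Measure.restrict_congr_set ?_
  have h : Ioo x y ⊆ Ioc x y ∩ link ℓ := fun t ht =>
    ⟨Ioo_subset_Ioc_self ht, Ioo_subset_link hy ⟨hx.trans_lt ht.1, ht.2⟩⟩
  refine (inter_subset_left.eventuallyLE).antisymm ?_
  exact (Ioo_ae_eq_Ioc (μ := volume)).symm.le.trans h.eventuallyLE

variable {E : Type*} [NormedAddCommGroup E]

theorem intervalIntegrable_iff_integrableOn_linkMeasure {x : ℝ} (hx : x ∈ closedLink ℓ)
    {h : ℝ → E} : IntervalIntegrable h volume 0 x ↔ IntegrableOn h (Ioc 0 x) (linkMeasure ℓ) := by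
  rw [intervalIntegrable_iff_integrableOn_Ioc_of_le hx.1, IntegrableOn, IntegrableOn,
    restrict_linkMeasure_Ioc le_rfl hx]

theorem ae_linkMeasure_notMem_Ioc {x : ℝ} {h : ℝ → E} (h0 : ∀ t ∈ link ℓ, x < t → h t = 0) :
    ∀ᵐ t ∂linkMeasure ℓ, t ∉ Ioc 0 x → h t = 0 := by
  filter_upwards [ae_restrict_mem (measurableSet_link ℓ)] with t ht hn
  exact h0 t ht (not_le.1 fun htx => hn ⟨ht.1, htx⟩)

theorem integrable_linkMeasure_of_intervalIntegrable {x : ℝ} (hx : x ∈ closedLink ℓ) {h : ℝ → E}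
    (hi : IntervalIntegrable h volume 0 x) (h0 : ∀ t ∈ link ℓ, x < t → h t = 0) :
    Integrable h (linkMeasure ℓ) :=
  ((intervalIntegrable_iff_integrableOn_linkMeasure hx).1 hi).integrable_of_ae_notMem_eq_zero
    (ae_linkMeasure_notMem_Ioc h0)

variable [NormedSpace ℝ E]

theorem intervalIntegral_eq_setIntegral_linkMeasure {x : ℝ} (hx : x ∈ closedLink ℓ) (h : ℝ → E) :
    ∫ t in (0 : ℝ)..x, h t = ∫ t in Ioc 0 x, h t ∂linkMeasure ℓ := by
  rw [intervalIntegral.integral_of_le hx.1, restrict_linkMeasure_Ioc le_rfl hx]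

theorem integral_linkMeasure_eq_intervalIntegral {x : ℝ} (hx : x ∈ closedLink ℓ) {h : ℝ → E}
    (h0 : ∀ t ∈ link ℓ, x < t → h t = 0) :
    ∫ t, h t ∂linkMeasure ℓ = ∫ t in (0 : ℝ)..x, h t := by
  rw [intervalIntegral_eq_setIntegral_linkMeasure hx]
  exact (setIntegral_eq_integral_of_ae_compl_eq_zero (ae_linkMeasure_notMem_Ioc h0)).symm

end Link

section AbsolutelyContinuous

variable {E : Type*} [NormedAddCommGroup E] [NormedSpace ℝ E] {a b : ℝ}

theorem absolutelyContinuousOnInterval_of_dist_le {X Y : Type*} [PseudoMetricSpace X]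
    [PseudoMetricSpace Y] {f : ℝ → X} {g : ℝ → Y} (hg : AbsolutelyContinuousOnInterval g a b)
    (h : ∀ u ∈ uIcc a b, ∀ v ∈ uIcc a b, dist (f u) (f v) ≤ dist (g u) (g v)) :
    AbsolutelyContinuousOnInterval f a b := by
  refine squeeze_zero' (Eventually.of_forall fun I => Finset.sum_nonneg fun i _ => dist_nonneg)
    ?_ hg
  filter_upwards [mem_inf_of_right (mem_principal_self _)] with I hI
  exact Finset.sum_le_sum fun i hi => h _ (hI.1 i hi).1 _ (hI.1 i hi).2

theorem absolutelyContinuousOnInterval_integral {f : ℝ → E} (hf : IntervalIntegrable f volume a b) :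
    AbsolutelyContinuousOnInterval (fun u => ∫ t in a..u, f t) a b := by
  have hf_uIcc : ∀ u ∈ uIcc a b, IntervalIntegrable f volume a u := fun u hu =>
    hf.mono_set (uIcc_subset_uIcc left_mem_uIcc hu)
  refine absolutelyContinuousOnInterval_of_dist_le
    (hf.norm.absolutelyContinuousOnInterval_intervalIntegral left_mem_uIcc) fun u hu v hv => ?_
  rw [dist_eq_norm, intervalIntegral.integral_interval_sub_left (hf_uIcc u hu) (hf_uIcc v hv),
    Real.dist_eq,
    intervalIntegral.integral_interval_sub_left (hf_uIcc u hu).norm (hf_uIcc v hv).norm]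
  exact intervalIntegral.norm_integral_le_abs_integral_norm

end AbsolutelyContinuous

section LocAC

variable {ℓ : EReal} {F p G q : ℝ → ℂ}

theorem HasLocACDeriv.absolutelyContinuousOnInterval (hF : HasLocACDeriv ℓ F p) {x : ℝ}
    (hx : x ∈ closedLink ℓ) : AbsolutelyContinuousOnInterval F 0 x := by
  refine absolutelyContinuousOnInterval_of_dist_le
    (absolutelyContinuousOnInterval_integral (hF x hx).1) fun u hu v hv => ?_
  rw [uIcc_of_le hx.1] at hu hv
  rw [(hF u (Icc_subset_closedLink hx hu)).2, (hF v (Icc_subset_closedLink hx hv)).2,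
    dist_add_left]

theorem HasLocACDeriv.continuousOn_Icc (hF : HasLocACDeriv ℓ F p) {x : ℝ} (hx : x ∈ closedLink ℓ) :
    ContinuousOn F (Icc 0 x) := by
  simpa only [uIcc_of_le hx.1] using (hF.absolutelyContinuousOnInterval hx).continuousOn

theorem HasLocACDeriv.continuousOn_link (hF : HasLocACDeriv ℓ F p) : ContinuousOn F (link ℓ) := by
  intro x hx
  obtain ⟨q, hxq, hq⟩ := exists_rat_mem_link_gt hx
  exact ((hF.continuousOn_Icc (link_subset_closedLink hq)).continuousAt
    (Icc_mem_nhds hx.1 hxq)).continuousWithinAt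

theorem HasLocACDeriv.aestronglyMeasurable (hF : HasLocACDeriv ℓ F p) :
    AEStronglyMeasurable F (linkMeasure ℓ) :=
  hF.continuousOn_link.aestronglyMeasurable (measurableSet_link ℓ)

theorem HasLocACDeriv.ae_hasDerivAt (hF : HasLocACDeriv ℓ F p) {x : ℝ} (hx : x ∈ closedLink ℓ) :
    ∀ᵐ u, u ∈ Ioo 0 x → HasDerivAt F (p u) u := by
  filter_upwards [(hF x hx).1.ae_hasDerivAt_integral] with u hu hux
  rw [uIcc_of_le hx.1] at hu
  have h_primitive : HasDerivAt (fun y => F 0 + ∫ t in (0 : ℝ)..y, p t) (p u) u :=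
    (hu (Ioo_subset_Icc_self hux) 0 (left_mem_Icc.2 hx.1)).const_add (F 0)
  refine h_primitive.congr_of_eventuallyEq ?_
  filter_upwards [isOpen_Ioo.mem_nhds hux] with y hy
  exact (hF y (Icc_subset_closedLink hx (Ioo_subset_Icc_self hy))).2

theorem hasLocACDeriv_of_ae_hasDerivAt
    (hF : ∀ x ∈ closedLink ℓ, AbsolutelyContinuousOnInterval F 0 x)
    (hp : ∀ x ∈ closedLink ℓ, IntervalIntegrable p volume 0 x)
    (hd : ∀ x ∈ closedLink ℓ, ∀ᵐ u, u ∈ Ioo 0 x → HasDerivAt F (p u) u) :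
    HasLocACDeriv ℓ F p := by
  intro x hx
  refine ⟨hp x hx, ?_⟩
  obtain ⟨C, hC⟩ :=
    ((hF x hx).sub
      (absolutelyContinuousOnInterval_integral (hp x hx))).const_of_ae_hasDerivAt_zero (by
        filter_upwards [hd x hx, (hp x hx).ae_hasDerivAt_integral, Ioo_ae_eq_Icc.mem_iff]
          with u hFu hpu hu_mem hu
        have huo : u ∈ Ioo 0 x := hu_mem.2 (by rwa [uIcc_of_le hx.1] at hu)
        simpa only [sub_self] using (hFu huo).sub (hpu hu 0 left_mem_uIcc))
  have hCx := hC x right_mem_uIcc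
  have hC0 := hC 0 left_mem_uIcc
  simp only [Pi.sub_apply, intervalIntegral.integral_same, sub_zero] at hCx hC0
  rw [hC0, ← hCx, sub_add_cancel]

theorem HasLocACDeriv.mul (hF : HasLocACDeriv ℓ F p) (hG : HasLocACDeriv ℓ G q) :
    HasLocACDeriv ℓ (fun x => F x * G x) (fun x => p x * G x + F x * q x) := by
  refine hasLocACDeriv_of_ae_hasDerivAt (fun x hx => ?_) (fun x hx => ?_) fun x hx => ?_
  · exact (hF.absolutelyContinuousOnInterval hx).smul (hG.absolutelyContinuousOnInterval hx)
  · exact ((hF x hx).1.mul_continuousOn (hG.absolutelyContinuousOnInterval hx).continuousOn).add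
      ((hG x hx).1.continuousOn_mul (hF.absolutelyContinuousOnInterval hx).continuousOn)
  · filter_upwards [hF.ae_hasDerivAt hx, hG.ae_hasDerivAt hx] with u hFu hGu hu
    exact (hFu hu).mul (hGu hu)

theorem HasLocACDeriv.conj (hF : HasLocACDeriv ℓ F p) :
    HasLocACDeriv ℓ (fun x => starRingEnd ℂ (F x)) (fun x => starRingEnd ℂ (p x)) := by
  intro x hx
  obtain ⟨hp, hFx⟩ := hF x hx
  refine ⟨⟨?_, ?_⟩, ?_⟩
  · exact Complex.conjCLE.toContinuousLinearMap.integrable_comp hp.1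
  · exact Complex.conjCLE.toContinuousLinearMap.integrable_comp hp.2
  · beta_reduce
    rw [hFx, map_add, intervalIntegral.integral_of_le hx.1, intervalIntegral.integral_of_le hx.1,
      integral_conj]

theorem HasLocACDeriv.congr_ae (hF : HasLocACDeriv ℓ F p) (h : p =ᵐ[linkMeasure ℓ] q) :
    HasLocACDeriv ℓ F q := by
  intro x hx
  obtain ⟨hp, hFx⟩ := hF x hx
  rw [intervalIntegrable_iff_integrableOn_linkMeasure hx] at hp ⊢
  rw [intervalIntegral_eq_setIntegral_linkMeasure hx] at hFx ⊢
  exact ⟨hp.congr (ae_restrict_of_ae h), by rw [hFx, integral_congr_ae (ae_restrict_of_ae h)]⟩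

theorem hasLocACDeriv_of_hasDerivAt (h : ∀ x, HasDerivAt F (p x) x) (hp : Continuous p) :
    HasLocACDeriv ℓ F p := fun x _ => by
  refine ⟨hp.intervalIntegrable _ _, ?_⟩
  rw [intervalIntegral.integral_eq_sub_of_hasDerivAt (fun t _ => h t) (hp.intervalIntegrable _ _),
    add_sub_cancel]

end LocAC

section L2

open scoped InnerProductSpace

variable {α : Type*} [MeasurableSpace α] {μ : Measure α}

theorem integrable_conj_mul_Lp (f g : Lp ℂ 2 μ) :
    Integrable (fun x => starRingEnd ℂ (f x) * g x) μ := by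
  simpa only [RCLike.inner_apply'] using L2.integrable_inner (𝕜 := ℂ) f g

theorem inner_Lp_eq_integral (f g : Lp ℂ 2 μ) :
    ⟪f, g⟫_ℂ = ∫ x, starRingEnd ℂ (f x) * g x ∂μ := by
  simp only [L2.inner_def, RCLike.inner_apply']

theorem sq_norm_Lp_eq_integral (f : Lp ℂ 2 μ) : ‖f‖ ^ 2 = ∫ x, ‖f x‖ ^ 2 ∂μ := by
  rw [← inner_self_eq_norm_sq (𝕜 := ℂ), L2.inner_def, ← integral_re (L2.integrable_inner f f)]
  simp only [inner_self_eq_norm_sq]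

end L2

section AeEqSubmodule

variable {α Q : Type*} [MeasurableSpace α] {μ : Measure α} [NormedAddCommGroup Q] [NormedSpace ℂ Q]
  {r : ENNReal} [Fact (1 ≤ r)]

/-- The vectors `p` whose image `P p` in `Lʳ(μ)` is represented by the function `x ↦ e x p`, for a
family `e` of functionals. -/
def aeEqSubmodule (P : Q →L[ℂ] Lp ℂ r μ) (e : α → Q →L[ℂ] ℂ) : Submodule ℂ Q where
  carrier := {p | P p =ᵐ[μ] fun x => e x p}
  zero_mem' := by
    change P 0 =ᵐ[μ] fun x => e x 0
    simp only [map_zero]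
    exact Lp.coeFn_zero ℂ r μ
  add_mem' := fun {p q} hp hq => by
    change P (p + q) =ᵐ[μ] fun x => e x (p + q)
    simp only [map_add]
    exact (Lp.coeFn_add _ _).trans (EventuallyEq.add hp hq)
  smul_mem' := fun c p hp => by
    change P (c • p) =ᵐ[μ] fun x => e x (c • p)
    simp only [map_smul]
    filter_upwards [Lp.coeFn_smul c (P p), hp] with x hcx hpx
    rw [hcx, Pi.smul_apply, hpx]

theorem isClosed_aeEqSubmodule (P : Q →L[ℂ] Lp ℂ r μ) (e : α → Q →L[ℂ] ℂ) :
    IsClosed (aeEqSubmodule P e : Set Q) := by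
  refine isSeqClosed_iff_isClosed.1 fun u p hu hup => ?_
  obtain ⟨φ, hφ, h_lim⟩ :=
    (tendstoInMeasure_of_tendsto_Lp ((P.continuous.tendsto p).comp hup)).exists_seq_tendsto_ae
  filter_upwards [h_lim, ae_all_iff.2 hu] with x hx hux
  refine tendsto_nhds_unique hx ?_
  simp only [Function.comp_apply, hux]
  exact (((e x).continuous.tendsto p).comp hup).comp hφ.tendsto_atTop

end AeEqSubmodule

section FormSpace

open scoped InnerProductSpace

variable {N : ℕ} {ℓ : Fin N → EReal}

/-- The ambient Hilbert space of the form domain: a function `ψ` on the graph is recorded by its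
value at the vertex and by the three states `ψ'`, `w ψ` and `s ψ`, where `w` and `s` are weights. -/
def FormSpace (ℓ : Fin N → EReal) : Type :=
  WithLp 2 (ℂ × PiLp 2 fun _ : Fin 3 => StateSpace ℓ)

instance : NormedAddCommGroup (FormSpace ℓ) :=
  inferInstanceAs (NormedAddCommGroup (WithLp 2 (ℂ × PiLp 2 fun _ : Fin 3 => StateSpace ℓ)))

instance : InnerProductSpace ℂ (FormSpace ℓ) :=
  inferInstanceAs (InnerProductSpace ℂ (WithLp 2 (ℂ × PiLp 2 fun _ : Fin 3 => StateSpace ℓ)))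

instance : CompleteSpace (FormSpace ℓ) :=
  inferInstanceAs (CompleteSpace (WithLp 2 (ℂ × PiLp 2 fun _ : Fin 3 => StateSpace ℓ)))

/-- The value at the vertex recorded by an element of `FormSpace`. -/
def vertex : FormSpace ℓ →L[ℂ] ℂ :=
  WithLp.fstL 2 ℂ ℂ _

/-- The `i`-th of the three states recorded by an element of `FormSpace`. -/
def formState (i : Fin 3) : FormSpace ℓ →L[ℂ] StateSpace ℓ :=
  PiLp.proj 2 (fun _ : Fin 3 => StateSpace ℓ) i ∘L WithLp.sndL 2 ℂ ℂ _

/-- The derivative on the `j`-th link. -/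
def derivPart (j : Fin N) : FormSpace ℓ →L[ℂ] Lp ℂ 2 (linkMeasure (ℓ j)) :=
  PiLp.proj 2 _ j ∘L formState 0

/-- The function on the `j`-th link multiplied by the weight `w`. -/
def weightedPart (j : Fin N) : FormSpace ℓ →L[ℂ] Lp ℂ 2 (linkMeasure (ℓ j)) :=
  PiLp.proj 2 _ j ∘L formState 1

/-- The function on the `j`-th link multiplied by the constant weight `s`. -/
def scaledPart (j : Fin N) : FormSpace ℓ →L[ℂ] Lp ℂ 2 (linkMeasure (ℓ j)) :=
  PiLp.proj 2 _ j ∘L formState 2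

theorem inner_formSpace (p q : FormSpace ℓ) :
    ⟪p, q⟫_ℂ = starRingEnd ℂ (vertex p) * vertex q +
      ∑ j, (⟪derivPart j p, derivPart j q⟫_ℂ + ⟪weightedPart j p, weightedPart j q⟫_ℂ +
        ⟪scaledPart j p, scaledPart j q⟫_ℂ) := by
  refine (WithLp.prod_inner_apply _ _).trans ?_
  rw [PiLp.inner_apply, Fin.sum_univ_three, PiLp.inner_apply, PiLp.inner_apply, PiLp.inner_apply,
    Finset.sum_add_distrib, Finset.sum_add_distrib, RCLike.inner_apply']
  rfl

theorem sq_norm_formSpace (p : FormSpace ℓ) :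
    ‖p‖ ^ 2 = ‖vertex p‖ ^ 2 +
      ∑ j, (‖derivPart j p‖ ^ 2 + ‖weightedPart j p‖ ^ 2 + ‖scaledPart j p‖ ^ 2) := by
  refine (WithLp.prod_norm_sq_eq_of_L2 _).trans ?_
  rw [PiLp.norm_sq_eq_of_L2, Fin.sum_univ_three, PiLp.norm_sq_eq_of_L2, PiLp.norm_sq_eq_of_L2,
    PiLp.norm_sq_eq_of_L2, Finset.sum_add_distrib, Finset.sum_add_distrib]
  rfl

theorem sq_norm_derivPart_add_sq_norm_scaledPart_le (p : FormSpace ℓ) (j : Fin N) :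
    ‖derivPart j p‖ ^ 2 + ‖scaledPart j p‖ ^ 2 ≤ ‖p‖ ^ 2 := by
  have h_single := Finset.single_le_sum
    (f := fun j => ‖derivPart j p‖ ^ 2 + ‖weightedPart j p‖ ^ 2 + ‖scaledPart j p‖ ^ 2)
    (fun _ _ => by positivity) (Finset.mem_univ j)
  rw [sq_norm_formSpace]
  linarith [sq_nonneg ‖vertex p‖, sq_nonneg ‖weightedPart j p‖]

end FormSpace

section PointEvaluation

open scoped InnerProductSpace

theorem linkMeasure_Ioc_ne_top (ℓ : EReal) (x y : ℝ) : linkMeasure ℓ (Ioc x y) ≠ ⊤ :=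
  ((Measure.restrict_apply_le _ _).trans_lt measure_Ioc_lt_top).ne

theorem integrableOn_Ioc_Lp {ℓ : EReal} (f : Lp ℂ 2 (linkMeasure ℓ)) (x y : ℝ) :
    IntegrableOn f (Ioc x y) (linkMeasure ℓ) :=
  integrableOn_Lp_of_measure_ne_top f one_le_two (linkMeasure_Ioc_ne_top ℓ x y)

theorem norm_indicatorConstLp_Ioc_le (ℓ : EReal) {x y : ℝ} (hxy : x ≤ y) :
    ‖indicatorConstLp 2 measurableSet_Ioc (linkMeasure_Ioc_ne_top ℓ x y) (1 : ℂ)‖ ≤ √(y - x) := by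
  have h_le : (linkMeasure ℓ).real (Ioc x y) ≤ y - x := by
    rw [← Real.volume_real_Ioc_of_le hxy]
    exact ENNReal.toReal_mono measure_Ioc_lt_top.ne (Measure.restrict_apply_le _ _)
  rw [norm_indicatorConstLp two_ne_zero ENNReal.ofNat_ne_top, norm_one, one_mul,
    ENNReal.toReal_ofNat, ← Real.sqrt_eq_rpow]
  exact Real.sqrt_le_sqrt h_le

variable {N : ℕ} {ℓ : Fin N → EReal}

/-- The value at the point `x` of the `j`-th link of the function with the recorded value at the
vertex and the recorded derivative. -/
def evalAt (j : Fin N) (x : ℝ) : FormSpace ℓ →L[ℂ] ℂ :=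
  vertex + innerSL ℂ (indicatorConstLp 2 measurableSet_Ioc
    (linkMeasure_Ioc_ne_top (ℓ j) 0 x) (1 : ℂ)) ∘L derivPart j

theorem evalAt_apply (j : Fin N) (x : ℝ) (p : FormSpace ℓ) :
    evalAt j x p = vertex p + ∫ t in Ioc 0 x, derivPart j p t ∂linkMeasure (ℓ j) := by
  rw [← L2.inner_indicatorConstLp_one measurableSet_Ioc (linkMeasure_Ioc_ne_top (ℓ j) 0 x)]
  rfl

theorem evalAt_zero (j : Fin N) : evalAt (ℓ := ℓ) j 0 = vertex := by
  ext p
  rw [evalAt_apply, Ioc_self, setIntegral_empty, add_zero]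

theorem hasLocACDeriv_evalAt (j : Fin N) (p : FormSpace ℓ) :
    HasLocACDeriv (ℓ j) (fun x => evalAt j x p) (derivPart j p) := fun x hx => by
  refine ⟨(intervalIntegrable_iff_integrableOn_linkMeasure hx).2 (integrableOn_Ioc_Lp _ _ _), ?_⟩
  beta_reduce
  rw [evalAt_zero, evalAt_apply, intervalIntegral_eq_setIntegral_linkMeasure hx]

theorem norm_evalAt_sub_le (j : Fin N) {x y : ℝ} (hx : 0 ≤ x) (hy : 0 ≤ y) (p : FormSpace ℓ) :
    ‖evalAt j y p - evalAt j x p‖ ≤ √|y - x| * ‖derivPart j p‖ := by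
  wlog hxy : x ≤ y generalizing x y
  · rw [norm_sub_rev, abs_sub_comm]
    exact this hy hx (le_of_not_ge hxy)
  have h_inner : evalAt j y p - evalAt j x p =
      ⟪indicatorConstLp 2 measurableSet_Ioc (linkMeasure_Ioc_ne_top (ℓ j) x y) (1 : ℂ),
        derivPart j p⟫_ℂ := by
    rw [L2.inner_indicatorConstLp_one, evalAt_apply, evalAt_apply, ← Ioc_union_Ioc_eq_Ioc hx hxy,
      setIntegral_union (Ioc_disjoint_Ioc_of_le le_rfl) measurableSet_Ioc
        (integrableOn_Ioc_Lp _ _ _) (integrableOn_Ioc_Lp _ _ _)]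
    ring
  rw [h_inner, abs_of_nonneg (sub_nonneg.2 hxy)]
  exact (norm_inner_le_norm _ _).trans
    (mul_le_mul_of_nonneg_right (norm_indicatorConstLp_Ioc_le _ hxy) (norm_nonneg _))

end PointEvaluation

section FormDomain

open scoped InnerProductSpace

variable {N : ℕ} {ℓ : Fin N → EReal} {ω : Fin N → ℝ} {w : Fin N → ℝ → ℝ} {s : ℝ}

/-- The functions in the form domain: the recorded states `ψ'`, `w ψ` and `s ψ` come from one
function `ψ`, which satisfies the Dirichlet conditions among the conditions at the ends of the
links. -/
def formSubmodule (ℓ : Fin N → EReal) (ω : Fin N → ℝ) (w : Fin N → ℝ → ℝ) (s : ℝ) :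
    Submodule ℂ (FormSpace ℓ) :=
  ⨅ j, aeEqSubmodule (weightedPart j) (fun x => (w j x : ℂ) • evalAt j x) ⊓
    aeEqSubmodule (scaledPart j) (fun x => (s : ℂ) • evalAt j x) ⊓
      ⨅ (b : ℝ) (_ : ℓ j = b) (_ : Real.sin (ω j) = 0), (evalAt j b).ker

theorem mem_formSubmodule {p : FormSpace ℓ} : p ∈ formSubmodule ℓ ω w s ↔ ∀ j,
    (weightedPart j p =ᵐ[linkMeasure (ℓ j)] fun x => (w j x : ℂ) * evalAt j x p) ∧
    (scaledPart j p =ᵐ[linkMeasure (ℓ j)] fun x => (s : ℂ) * evalAt j x p) ∧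
    ∀ b : ℝ, ℓ j = b → Real.sin (ω j) = 0 → evalAt j b p = 0 := by
  simp only [formSubmodule, Submodule.mem_iInf, Submodule.mem_inf, and_assoc]
  rfl

theorem isClosed_formSubmodule : IsClosed (formSubmodule ℓ ω w s : Set (FormSpace ℓ)) := by
  simp only [formSubmodule, Submodule.coe_iInf, Submodule.coe_inf]
  exact isClosed_iInter fun j =>
    ((isClosed_aeEqSubmodule _ _).inter (isClosed_aeEqSubmodule _ _)).inter <|
      isClosed_iInter fun b => isClosed_iInter fun _ => isClosed_iInter fun _ =>
        (evalAt j b).isClosed_ker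

/-- The form domain as a Hilbert space, with the norm of the ambient `FormSpace`. -/
def FormDomain (ℓ : Fin N → EReal) (ω : Fin N → ℝ) (w : Fin N → ℝ → ℝ) (s : ℝ) : Type :=
  formSubmodule ℓ ω w s

instance : NormedAddCommGroup (FormDomain ℓ ω w s) :=
  inferInstanceAs (NormedAddCommGroup (formSubmodule ℓ ω w s))

instance : InnerProductSpace ℂ (FormDomain ℓ ω w s) :=
  inferInstanceAs (InnerProductSpace ℂ (formSubmodule ℓ ω w s))

instance : CompleteSpace (FormDomain ℓ ω w s) :=
  isClosed_formSubmodule.completeSpace_coe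

/-- The inclusion of the form domain into the ambient `FormSpace`. -/
def formSubtype (ℓ : Fin N → EReal) (ω : Fin N → ℝ) (w : Fin N → ℝ → ℝ) (s : ℝ) :
    FormDomain ℓ ω w s →L[ℂ] FormSpace ℓ :=
  (formSubmodule ℓ ω w s).subtypeL

theorem weightedPart_ae_eq (p : FormDomain ℓ ω w s) (j : Fin N) :
    weightedPart j p.1 =ᵐ[linkMeasure (ℓ j)] fun x => (w j x : ℂ) * evalAt j x p.1 :=
  (mem_formSubmodule.1 p.2 j).1

theorem scaledPart_ae_eq (p : FormDomain ℓ ω w s) (j : Fin N) :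
    scaledPart j p.1 =ᵐ[linkMeasure (ℓ j)] fun x => (s : ℂ) * evalAt j x p.1 :=
  (mem_formSubmodule.1 p.2 j).2.1

theorem evalAt_eq_zero_of_sin_eq_zero (p : FormDomain ℓ ω w s) {j : Fin N} {b : ℝ} (hb : ℓ j = b)
    (hω : Real.sin (ω j) = 0) : evalAt j b p.1 = 0 :=
  (mem_formSubmodule.1 p.2 j).2.2 b hb hω

/-- The inclusion of the form domain into the state space. -/
def formInclusion (ℓ : Fin N → EReal) (ω : Fin N → ℝ) (w : Fin N → ℝ → ℝ) (s : ℝ) :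
    FormDomain ℓ ω w s →L[ℂ] StateSpace ℓ :=
  (s⁻¹ : ℂ) • (formState 2 ∘L formSubtype ℓ ω w s)

theorem formInclusion_ae_eq (hs : s ≠ 0) (p : FormDomain ℓ ω w s) (j : Fin N) :
    formInclusion ℓ ω w s p j =ᵐ[linkMeasure (ℓ j)] fun x => evalAt j x p.1 := by
  refine (Lp.coeFn_smul (s⁻¹ : ℂ) (scaledPart j p.1)).trans ?_
  filter_upwards [scaledPart_ae_eq p j] with x hx
  rw [Pi.smul_apply, hx, smul_eq_mul, inv_mul_cancel_left₀ (Complex.ofReal_ne_zero.2 hs)]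

theorem memLp_evalAt (hs : s ≠ 0) (p : FormDomain ℓ ω w s) (j : Fin N) :
    MemLp (fun x => evalAt j x p.1) 2 (linkMeasure (ℓ j)) :=
  (memLp_congr_ae (formInclusion_ae_eq hs p j)).1 (Lp.memLp _)

/-- The density on the `j`-th link of the energy form of `-ψ'' + v ψ`. -/
def energyDensity (v : ℝ → ℝ) (p q : FormSpace ℓ) (j : Fin N) (x : ℝ) : ℂ :=
  starRingEnd ℂ (derivPart j p x) * derivPart j q x +
    (v x : ℂ) * (starRingEnd ℂ (evalAt j x p) * evalAt j x q)

theorem energyDensity_ae_eq (p q : FormDomain ℓ ω w s) (j : Fin N) :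
    (fun x => starRingEnd ℂ (derivPart j p.1 x) * derivPart j q.1 x +
      starRingEnd ℂ (weightedPart j p.1 x) * weightedPart j q.1 x +
        starRingEnd ℂ (scaledPart j p.1 x) * scaledPart j q.1 x) =ᵐ[linkMeasure (ℓ j)]
      energyDensity (fun x => w j x ^ 2 + s ^ 2) p.1 q.1 j := by
  filter_upwards [weightedPart_ae_eq p j, weightedPart_ae_eq q j, scaledPart_ae_eq p j,
    scaledPart_ae_eq q j] with x hwp hwq hsp hsq
  simp only [energyDensity, hwp, hwq, hsp, hsq, map_mul, Complex.conj_ofReal]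
  push_cast
  ring

theorem integrable_energyDensity (p q : FormDomain ℓ ω w s) (j : Fin N) :
    Integrable (energyDensity (fun x => w j x ^ 2 + s ^ 2) p.1 q.1 j) (linkMeasure (ℓ j)) :=
  (((integrable_conj_mul_Lp _ _).add (integrable_conj_mul_Lp _ _)).add
    (integrable_conj_mul_Lp _ _)).congr (energyDensity_ae_eq p q j)

theorem inner_formDomain (p q : FormDomain ℓ ω w s) :
    ⟪p, q⟫_ℂ = starRingEnd ℂ (vertex p.1) * vertex q.1 +
      ∑ j, ∫ x, energyDensity (fun x => w j x ^ 2 + s ^ 2) p.1 q.1 j x ∂linkMeasure (ℓ j) := by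
  refine (inner_formSpace p.1 q.1).trans ?_
  congr 1
  refine Finset.sum_congr rfl fun j _ => ?_
  rw [inner_Lp_eq_integral, inner_Lp_eq_integral, inner_Lp_eq_integral,
    ← integral_congr_ae (energyDensity_ae_eq p q j), integral_add, integral_add]
  all_goals first
    | exact integrable_conj_mul_Lp _ _
    | exact (integrable_conj_mul_Lp _ _).add (integrable_conj_mul_Lp _ _)

theorem exists_mem_formDomain (hℓ : ∀ j, 0 < ℓ j) {f f' : Fin N → ℝ → ℂ} {c : ℂ}
    (hf : ∀ j, HasLocACDeriv (ℓ j) (f j) (f' j)) (hc : ∀ j, f j 0 = c)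
    (hf'_memLp : ∀ j, MemLp (f' j) 2 (linkMeasure (ℓ j)))
    (hwf_memLp : ∀ j, MemLp (fun x => (w j x : ℂ) * f j x) 2 (linkMeasure (ℓ j)))
    (hf_memLp : ∀ j, MemLp (f j) 2 (linkMeasure (ℓ j)))
    (hD : ∀ j, ∀ b : ℝ, ℓ j = b → Real.sin (ω j) = 0 → f j b = 0) :
    ∃ q : FormDomain ℓ ω w s, vertex q.1 = c ∧
      (∀ j, derivPart j q.1 =ᵐ[linkMeasure (ℓ j)] f' j) ∧
      ∀ j, ∀ x ∈ closedLink (ℓ j), evalAt j x q.1 = f j x := by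
  let q : FormSpace ℓ := WithLp.toLp 2 (c, WithLp.toLp 2
    ![WithLp.toLp 2 fun j => (hf'_memLp j).toLp, WithLp.toLp 2 fun j => (hwf_memLp j).toLp,
      WithLp.toLp 2 fun j => ((hf_memLp j).const_mul (s : ℂ)).toLp])
  have h_deriv : ∀ j, derivPart j q =ᵐ[linkMeasure (ℓ j)] f' j := fun j =>
    (hf'_memLp j).coeFn_toLp
  have h_eval : ∀ j, ∀ x ∈ closedLink (ℓ j), evalAt j x q = f j x := fun j x hx => by
    rw [evalAt_apply, (hf j x hx).2, hc, intervalIntegral_eq_setIntegral_linkMeasure hx,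
      integral_congr_ae (ae_restrict_of_ae (h_deriv j))]
    rfl
  refine ⟨⟨q, mem_formSubmodule.2 fun j => ⟨?_, ?_, fun b hb hω => ?_⟩⟩, rfl, h_deriv, h_eval⟩
  · have h_weighted : weightedPart j q =ᵐ[linkMeasure (ℓ j)] fun x => (w j x : ℂ) * f j x :=
      (hwf_memLp j).coeFn_toLp
    filter_upwards [h_weighted, ae_restrict_mem (measurableSet_link (ℓ j))] with x hx hxℓ
    rw [hx, h_eval j x (link_subset_closedLink hxℓ)]
  · have h_scaled : scaledPart j q =ᵐ[linkMeasure (ℓ j)] fun x => (s : ℂ) * f j x :=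
      ((hf_memLp j).const_mul (s : ℂ)).coeFn_toLp
    filter_upwards [h_scaled, ae_restrict_mem (measurableSet_link (ℓ j))] with x hx hxℓ
    rw [hx, h_eval j x (link_subset_closedLink hxℓ)]
  · have hb0 : (0 : EReal) < b := hb ▸ hℓ j
    rw [h_eval j b ⟨EReal.coe_nonneg.1 hb0.le, hb.ge⟩, hD j b hb hω]

end FormDomain

section TraceInequality

theorem exists_window_subset_closedLink {ℓ : EReal} {L x : ℝ} (hL : 0 ≤ L) (hLℓ : (L : EReal) ≤ ℓ)
    (hx : x ∈ closedLink ℓ) : ∃ a, 0 ≤ a ∧ a + L ∈ closedLink ℓ ∧ x ∈ Icc a (a + L) := by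
  rcases le_total x L with h | h
  · exact ⟨0, le_rfl, ⟨by rwa [zero_add], by rwa [zero_add]⟩, hx.1, by rwa [zero_add]⟩
  · refine ⟨x - L, sub_nonneg.2 h, ?_, sub_le_self x hL, (sub_add_cancel x L).ge⟩
    rwa [sub_add_cancel]

variable {N : ℕ} {ℓ : Fin N → EReal} {ω : Fin N → ℝ} {w : Fin N → ℝ → ℝ} {s : ℝ}

theorem sq_norm_evalAt_le_of_abs_sub_le (j : Fin N) {L x y : ℝ} (hx : 0 ≤ x) (hy : 0 ≤ y)
    (hxy : |x - y| ≤ L) (p : FormSpace ℓ) :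
    ‖evalAt j x p‖ ^ 2 ≤ 2 * ‖evalAt j y p‖ ^ 2 + 2 * L * ‖derivPart j p‖ ^ 2 := by
  have hL : 0 ≤ L := (abs_nonneg _).trans hxy
  have h_sub : ‖evalAt j x p - evalAt j y p‖ ≤ √L * ‖derivPart j p‖ :=
    (norm_evalAt_sub_le j hy hx p).trans
      (mul_le_mul_of_nonneg_right (Real.sqrt_le_sqrt hxy) (norm_nonneg _))
  calc ‖evalAt j x p‖ ^ 2 ≤ (‖evalAt j y p‖ + √L * ‖derivPart j p‖) ^ 2 := by
        gcongr
        linarith [norm_sub_norm_le (evalAt j x p) (evalAt j y p)]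
    _ ≤ 2 * (‖evalAt j y p‖ ^ 2 + (√L * ‖derivPart j p‖) ^ 2) := add_sq_le
    _ = 2 * ‖evalAt j y p‖ ^ 2 + 2 * L * ‖derivPart j p‖ ^ 2 := by
        rw [mul_pow, Real.sq_sqrt hL]
        ring

theorem mul_sq_norm_evalAt_le {L : ℝ} (hL : 0 ≤ L) {j : Fin N} (hLℓ : (L : EReal) ≤ ℓ j)
    {p : FormSpace ℓ} (hp : MemLp (fun y => evalAt j y p) 2 (linkMeasure (ℓ j))) {x : ℝ}
    (hx : x ∈ closedLink (ℓ j)) :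
    L * ‖evalAt j x p‖ ^ 2 ≤
      2 * (∫ y, ‖evalAt j y p‖ ^ 2 ∂linkMeasure (ℓ j)) + 2 * L ^ 2 * ‖derivPart j p‖ ^ 2 := by
  obtain ⟨a, ha, haL, hxa⟩ := exists_window_subset_closedLink hL hLℓ hx
  have h_int := hp.integrable_norm_pow two_ne_zero
  have h_const : ∀ k : ℝ, ∫ _ in Ioc a (a + L), k ∂linkMeasure (ℓ j) = L * k := fun k => by
    rw [restrict_linkMeasure_Ioc ha haL, setIntegral_const,
      Real.volume_real_Ioc_of_le (le_add_of_nonneg_right hL), add_sub_cancel_left, smul_eq_mul]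
  have h_int_const : ∀ k : ℝ, IntegrableOn (fun _ => k) (Ioc a (a + L)) (linkMeasure (ℓ j)) :=
    fun k => integrableOn_const (linkMeasure_Ioc_ne_top _ _ _)
  calc L * ‖evalAt j x p‖ ^ 2
      = ∫ _ in Ioc a (a + L), ‖evalAt j x p‖ ^ 2 ∂linkMeasure (ℓ j) := (h_const _).symm
    _ ≤ ∫ y in Ioc a (a + L), (2 * ‖evalAt j y p‖ ^ 2 + 2 * L * ‖derivPart j p‖ ^ 2)
          ∂linkMeasure (ℓ j) := by
        refine setIntegral_mono_on (h_int_const _)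
          ((h_int.restrict.const_mul 2).add (h_int_const _)) measurableSet_Ioc fun y hy => ?_
        refine sq_norm_evalAt_le_of_abs_sub_le j hx.1 (ha.trans hy.1.le) (abs_le.2 ⟨?_, ?_⟩) p
        · linarith [hxa.1, hy.2]
        · linarith [hxa.2, hy.1]
    _ = 2 * (∫ y in Ioc a (a + L), ‖evalAt j y p‖ ^ 2 ∂linkMeasure (ℓ j)) +
          2 * L ^ 2 * ‖derivPart j p‖ ^ 2 := by
        rw [integral_add (h_int.restrict.const_mul 2) (h_int_const _), h_const,
          integral_const_mul]
        ring
    _ ≤ _ := by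
        gcongr
        · exact Eventually.of_forall fun y => sq_nonneg _
        · exact Measure.restrict_le_self

theorem sq_norm_evalAt_le {L : ℝ} (hsL : s * L = 1) (hL : 0 < L) {j : Fin N}
    (hLℓ : (L : EReal) ≤ ℓ j) (p : FormDomain ℓ ω w s) {x : ℝ} (hx : x ∈ closedLink (ℓ j)) :
    ‖evalAt j x p.1‖ ^ 2 ≤ 2 * L * ‖p‖ ^ 2 := by
  have h_scaled :
      ‖scaledPart j p.1‖ ^ 2 = s ^ 2 * ∫ y, ‖evalAt j y p.1‖ ^ 2 ∂linkMeasure (ℓ j) := by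
    rw [sq_norm_Lp_eq_integral, ← integral_const_mul]
    refine integral_congr_ae ?_
    filter_upwards [scaledPart_ae_eq p j] with y hy
    rw [hy, norm_mul, mul_pow, Complex.norm_real, Real.norm_eq_abs, sq_abs]
  have h_norm : L ^ 2 * (‖derivPart j p.1‖ ^ 2 + ‖scaledPart j p.1‖ ^ 2) ≤ L ^ 2 * ‖p‖ ^ 2 :=
    mul_le_mul_of_nonneg_left (sq_norm_derivPart_add_sq_norm_scaledPart_le p.1 j) (sq_nonneg L)
  have hL_scaled :
      L ^ 2 * ‖scaledPart j p.1‖ ^ 2 = ∫ y, ‖evalAt j y p.1‖ ^ 2 ∂linkMeasure (ℓ j) := by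
    rw [h_scaled, ← mul_assoc, ← mul_pow, mul_comm L, hsL, one_pow, one_mul]
  have h_average :=
    mul_sq_norm_evalAt_le hL.le hLℓ (memLp_evalAt (left_ne_zero_of_mul_eq_one hsL) p j) hx
  refine le_of_mul_le_mul_left ?_ hL
  linarith

end TraceInequality

section SquareOperator

open scoped InnerProductSpace

variable {Q : Type*} [NormedAddCommGroup Q] [InnerProductSpace ℂ Q] [CompleteSpace Q]

/-- The positive operator representing the form `conj (e p) * e q` of a functional `e`. -/
def squareOperator (e : Q →L[ℂ] ℂ) : Q →L[ℂ] Q :=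
  ContinuousLinearMap.adjoint e ∘L e

theorem inner_squareOperator_right (e : Q →L[ℂ] ℂ) (p q : Q) :
    ⟪p, squareOperator e q⟫_ℂ = starRingEnd ℂ (e p) * e q := by
  rw [squareOperator, ContinuousLinearMap.comp_apply, ContinuousLinearMap.adjoint_inner_right,
    RCLike.inner_apply']

theorem isSelfAdjoint_squareOperator (e : Q →L[ℂ] ℂ) : IsSelfAdjoint (squareOperator e) :=
  (ContinuousLinearMap.isPositive_adjoint_comp_self e).isSelfAdjoint

theorem norm_squareOperator_le {e : Q →L[ℂ] ℂ} {κ : ℝ} (he : ‖e‖ ≤ κ) :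
    ‖squareOperator e‖ ≤ κ ^ 2 := by
  rw [squareOperator, ContinuousLinearMap.norm_adjoint_comp_self, sq]
  exact mul_self_le_mul_self (norm_nonneg e) he

theorem isSelfAdjoint_smul_squareOperator (a : ℝ) (e : Q →L[ℂ] ℂ) :
    IsSelfAdjoint (a • squareOperator e) := by
  rw [IsSelfAdjoint, star_smul, star_trivial, (isSelfAdjoint_squareOperator e).star_eq]

theorem norm_smul_squareOperator_le (a : ℝ) {e : Q →L[ℂ] ℂ} {κ : ℝ} (he : ‖e‖ ≤ κ) :
    ‖a • squareOperator e‖ ≤ |a| * κ ^ 2 := by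
  rw [norm_smul, Real.norm_eq_abs]
  exact mul_le_mul_of_nonneg_left (norm_squareOperator_le he) (abs_nonneg a)

theorem continuous_squareOperator : Continuous (squareOperator : (Q →L[ℂ] ℂ) → Q →L[ℂ] Q) :=
  (ContinuousLinearMap.adjoint (𝕜 := ℂ)).continuous.clm_comp continuous_id

variable {X : Type*} [MeasurableSpace X] {μ : Measure X} {u : X → ℝ} {e : X → Q →L[ℂ] ℂ} {κ : ℝ}

theorem integrable_smul_squareOperator (hu : Integrable u μ) (he : AEStronglyMeasurable e μ)
    (hκ : ∀ᵐ x ∂μ, ‖e x‖ ≤ κ) : Integrable (fun x => u x • squareOperator (e x)) μ :=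
  hu.smul_bdd (κ ^ 2) (continuous_squareOperator.comp_aestronglyMeasurable he)
    (hκ.mono fun _ hx => norm_squareOperator_le hx)

theorem isSelfAdjoint_integral_smul_squareOperator :
    IsSelfAdjoint (∫ x, u x • squareOperator (e x) ∂μ) := by
  rw [IsSelfAdjoint, ← starL'_apply (R := ℝ), ← ContinuousLinearEquiv.integral_comp_comm]
  refine integral_congr_ae (Eventually.of_forall fun x => ?_)
  simp only [starL'_apply, (isSelfAdjoint_smul_squareOperator (u x) (e x)).star_eq]

theorem norm_integral_smul_squareOperator_le (hu : Integrable u μ) (hκ : ∀ᵐ x ∂μ, ‖e x‖ ≤ κ) :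
    ‖∫ x, u x • squareOperator (e x) ∂μ‖ ≤ (∫ x, |u x| ∂μ) * κ ^ 2 := by
  rw [← integral_mul_const]
  refine norm_integral_le_of_norm_le (hu.abs.mul_const _) ?_
  filter_upwards [hκ] with x hx
  exact norm_smul_squareOperator_le (u x) hx

theorem inner_smul_squareOperator_right (a : ℝ) (e : Q →L[ℂ] ℂ) (p q : Q) :
    ⟪p, (a • squareOperator e) q⟫_ℂ = (a : ℂ) * (starRingEnd ℂ (e p) * e q) := by
  rw [smul_apply, inner_smul_right_eq_smul, inner_squareOperator_right,
    Complex.real_smul]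

theorem inner_integral_smul_squareOperator_right
    (h : Integrable (fun x => u x • squareOperator (e x)) μ) (p q : Q) :
    ⟪p, (∫ x, u x • squareOperator (e x) ∂μ) q⟫_ℂ =
      ∫ x, (u x : ℂ) * (starRingEnd ℂ (e x p) * e x q) ∂μ := by
  rw [ContinuousLinearMap.integral_apply h, ← integral_inner (h.apply_continuousLinearMap q)]
  simp only [inner_smul_squareOperator_right]

theorem integrable_mul_conj_mul (h : Integrable (fun x => u x • squareOperator (e x)) μ) (p q : Q) :
    Integrable (fun x => (u x : ℂ) * (starRingEnd ℂ (e x p) * e x q)) μ := by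
  simpa only [inner_smul_squareOperator_right] using
    (h.apply_continuousLinearMap q).const_inner (𝕜 := ℂ) p

end SquareOperator

section Coupling

open scoped InnerProductSpace

variable {N : ℕ} {ℓ : Fin N → EReal} {ω : Fin N → ℝ} {w : Fin N → ℝ → ℝ} {s κ : ℝ}

/-- The value at the vertex, as a functional on the form domain. -/
def vertexEval (ℓ : Fin N → EReal) (ω : Fin N → ℝ) (w : Fin N → ℝ → ℝ) (s : ℝ) :
    FormDomain ℓ ω w s →L[ℂ] ℂ :=
  vertex ∘L formSubtype ℓ ω w s

/-- The value at the point `x` of the `j`-th link, as a functional on the form domain. -/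
def formEval (ℓ : Fin N → EReal) (ω : Fin N → ℝ) (w : Fin N → ℝ → ℝ) (s : ℝ) (j : Fin N) (x : ℝ) :
    FormDomain ℓ ω w s →L[ℂ] ℂ :=
  evalAt j x ∘L formSubtype ℓ ω w s

theorem formEval_zero (j : Fin N) : formEval ℓ ω w s j 0 = vertexEval ℓ ω w s := by
  rw [formEval, evalAt_zero, vertexEval]

theorem continuousOn_formEval (j : Fin N) : ContinuousOn (formEval ℓ ω w s j) (Ici 0) := by
  intro x hx
  have h_dist : ∀ y ∈ Ici (0 : ℝ), ‖formEval ℓ ω w s j y - formEval ℓ ω w s j x‖ ≤ √|y - x| :=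
    fun y hy => ContinuousLinearMap.opNorm_le_bound _ (Real.sqrt_nonneg _) fun p => by
      refine (norm_evalAt_sub_le j hx hy p.1).trans
        (mul_le_mul_of_nonneg_left ?_ (Real.sqrt_nonneg _))
      refine abs_le_of_sq_le_sq' ?_ (norm_nonneg _) |>.2
      exact (le_add_of_nonneg_right (sq_nonneg _)).trans
        (sq_norm_derivPart_add_sq_norm_scaledPart_le p.1 j)
  have h_sqrt : Tendsto (fun y => √|y - x|) (𝓝[Ici 0] x) (𝓝 0) := by
    have h_cont : Continuous fun y : ℝ => √|y - x| := by fun_prop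
    simpa using (h_cont.tendsto x).mono_left nhdsWithin_le_nhds
  refine tendsto_iff_norm_sub_tendsto_zero.2 ?_
  exact squeeze_zero' (Eventually.of_forall fun _ => norm_nonneg _)
    (eventually_nhdsWithin_of_forall h_dist) h_sqrt

theorem aestronglyMeasurable_formEval (j : Fin N) :
    AEStronglyMeasurable (formEval ℓ ω w s j) (linkMeasure (ℓ j)) :=
  ((continuousOn_formEval j).mono fun _ hx => hx.1.le).aestronglyMeasurable (measurableSet_link _)

/-- The point evaluations on the form domain are bounded by `κ`. -/
def TraceBound (ℓ : Fin N → EReal) (ω : Fin N → ℝ) (w : Fin N → ℝ → ℝ) (s κ : ℝ) : Prop :=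
  ∀ j, ∀ x ∈ closedLink (ℓ j), ‖formEval ℓ ω w s j x‖ ≤ κ

theorem traceBound_sqrt {L : ℝ} (hsL : s * L = 1) (hL : 0 < L) (hLℓ : ∀ j, (L : EReal) ≤ ℓ j) :
    TraceBound ℓ ω w s √(2 * L) := fun j x hx =>
  ContinuousLinearMap.opNorm_le_bound _ (Real.sqrt_nonneg _) fun p => by
    refine abs_le_of_sq_le_sq' ?_ (by positivity) |>.2
    rw [mul_pow, Real.sq_sqrt (by positivity)]
    exact sq_norm_evalAt_le hsL hL (hLℓ j) p hx

theorem TraceBound.ae_norm_formEval_le (hκ : TraceBound ℓ ω w s κ) (j : Fin N) :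
    ∀ᵐ x ∂linkMeasure (ℓ j), ‖formEval ℓ ω w s j x‖ ≤ κ := by
  filter_upwards [ae_restrict_mem (measurableSet_link (ℓ j))] with x hx
  exact hκ j x (link_subset_closedLink hx)

theorem TraceBound.norm_vertexEval_le (hκ : TraceBound ℓ ω w s κ) (hN : 0 < N)
    (hℓ : ∀ j, 0 < ℓ j) : ‖vertexEval ℓ ω w s‖ ≤ κ := by
  rw [← formEval_zero ⟨0, hN⟩]
  exact hκ _ 0 (zero_mem_closedLink (hℓ _))

theorem TraceBound.integrable_smul_squareOperator (hκ : TraceBound ℓ ω w s κ) {j : Fin N}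
    {U : ℝ → ℝ} (hU : Integrable U (linkMeasure (ℓ j))) :
    Integrable (fun x => U x • squareOperator (formEval ℓ ω w s j x)) (linkMeasure (ℓ j)) :=
  StarGraph.integrable_smul_squareOperator hU (aestronglyMeasurable_formEval j)
    (hκ.ae_norm_formEval_le j)

theorem toReal_mem_closedLink {ℓ : EReal} (hℓ : 0 < ℓ) : ℓ.toReal ∈ closedLink ℓ := by
  refine ⟨EReal.toReal_nonneg hℓ.le, ?_⟩
  induction ℓ with
  | bot => simp at hℓ
  | top => exact le_top
  | coe x => simp

/-- The operator on the form domain representing the form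
`(α - 1) ψ(0) φ(0) + ∑ⱼ (∫ Uⱼ ψⱼ φⱼ + θⱼ ψⱼ(ℓⱼ) φⱼ(ℓⱼ))`, antilinear in `ψ`. The summand
`-ψ(0) φ(0)` compensates the vertex value in the inner product of the form domain. -/
def couplingOperator (ℓ : Fin N → EReal) (ω : Fin N → ℝ) (w : Fin N → ℝ → ℝ) (s α : ℝ)
    (U : Fin N → ℝ → ℝ) (θ : Fin N → ℝ) : FormDomain ℓ ω w s →L[ℂ] FormDomain ℓ ω w s :=
  (α - 1) • squareOperator (vertexEval ℓ ω w s) +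
    ∑ j, (∫ x, U j x • squareOperator (formEval ℓ ω w s j x) ∂linkMeasure (ℓ j) +
      θ j • squareOperator (formEval ℓ ω w s j (ℓ j).toReal))

variable {α : ℝ} {U : Fin N → ℝ → ℝ} {θ : Fin N → ℝ}

theorem isSelfAdjoint_couplingOperator : IsSelfAdjoint (couplingOperator ℓ ω w s α U θ) :=
  (isSelfAdjoint_smul_squareOperator _ _).add <| isSelfAdjoint_sum _ fun _ _ =>
    isSelfAdjoint_integral_smul_squareOperator.add (isSelfAdjoint_smul_squareOperator _ _)

theorem norm_couplingOperator_le (hN : 0 < N) (hℓ : ∀ j, 0 < ℓ j) (hκ : TraceBound ℓ ω w s κ)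
    (hU : ∀ j, Integrable (U j) (linkMeasure (ℓ j))) :
    ‖couplingOperator ℓ ω w s α U θ‖ ≤
      (|α - 1| + ∑ j, (∫ x, |U j x| ∂linkMeasure (ℓ j) + |θ j|)) * κ ^ 2 := by
  rw [add_mul, Finset.sum_mul]
  refine norm_add_le_of_le (norm_smul_squareOperator_le _ (hκ.norm_vertexEval_le hN hℓ)) ?_
  refine norm_sum_le_of_le _ fun j _ => ?_
  rw [add_mul]
  exact norm_add_le_of_le (norm_integral_smul_squareOperator_le (hU j) (hκ.ae_norm_formEval_le j))
    (norm_smul_squareOperator_le _ (hκ j _ (toReal_mem_closedLink (hℓ j))))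

theorem inner_couplingOperator_right (hκ : TraceBound ℓ ω w s κ)
    (hU : ∀ j, Integrable (U j) (linkMeasure (ℓ j))) (p q : FormDomain ℓ ω w s) :
    ⟪p, couplingOperator ℓ ω w s α U θ q⟫_ℂ =
      ((α - 1 : ℝ) : ℂ) * (starRingEnd ℂ (vertex p.1) * vertex q.1) +
        ∑ j, (∫ x, (U j x : ℂ) * (starRingEnd ℂ (evalAt j x p.1) * evalAt j x q.1)
            ∂linkMeasure (ℓ j) +
          (θ j : ℂ) *
            (starRingEnd ℂ (evalAt j (ℓ j).toReal p.1) * evalAt j (ℓ j).toReal q.1)) := by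
  rw [couplingOperator, add_apply, inner_add_right,
    inner_smul_squareOperator_right, sum_apply, inner_sum]
  congr 1
  refine Finset.sum_congr rfl fun j _ => ?_
  rw [add_apply, inner_add_right, inner_smul_squareOperator_right,
    inner_integral_smul_squareOperator_right (hκ.integrable_smul_squareOperator (hU j))]
  rfl

end Coupling

section Energy

open scoped InnerProductSpace

variable {N : ℕ} {ℓ : Fin N → EReal} {ω : Fin N → ℝ} {V U : Fin N → ℝ → ℝ} {m s κ : ℝ}

/-- The weight `√(V - m)` of the form domain of a potential `V ≥ m`. -/
def formWeight (V : Fin N → ℝ → ℝ) (m : ℝ) : Fin N → ℝ → ℝ :=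
  fun j x => √(V j x - m)

theorem energyDensity_formWeight_add_ae_eq {j : Fin N}
    (hm : ∀ᵐ x ∂linkMeasure (ℓ j), m ≤ V j x) (p q : FormSpace ℓ) :
    (fun x => energyDensity (fun x => formWeight V m j x ^ 2 + s ^ 2) p q j x +
      (U j x : ℂ) * (starRingEnd ℂ (evalAt j x p) * evalAt j x q)) =ᵐ[linkMeasure (ℓ j)]
      energyDensity (fun x => V j x + U j x - m + s ^ 2) p q j := by
  filter_upwards [hm] with x hx
  rw [energyDensity, energyDensity, formWeight, Real.sq_sqrt (sub_nonneg.2 hx)]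
  push_cast
  ring

theorem integrable_energyDensity_add (hm : ∀ j, ∀ᵐ x ∂linkMeasure (ℓ j), m ≤ V j x)
    (hκ : TraceBound ℓ ω (formWeight V m) s κ) {j : Fin N}
    (hU : Integrable (U j) (linkMeasure (ℓ j))) (p q : FormDomain ℓ ω (formWeight V m) s) :
    Integrable (energyDensity (fun x => V j x + U j x - m + s ^ 2) p.1 q.1 j)
      (linkMeasure (ℓ j)) :=
  ((integrable_energyDensity p q j).add (integrable_mul_conj_mul
    (hκ.integrable_smul_squareOperator hU) p q)).congr
      (energyDensity_formWeight_add_ae_eq (hm j) p.1 q.1)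

theorem inner_add_inner_couplingOperator (hm : ∀ j, ∀ᵐ x ∂linkMeasure (ℓ j), m ≤ V j x)
    (hκ : TraceBound ℓ ω (formWeight V m) s κ) {α : ℝ}
    (hU : ∀ j, Integrable (U j) (linkMeasure (ℓ j))) {θ : Fin N → ℝ}
    (p q : FormDomain ℓ ω (formWeight V m) s) :
    ⟪p, q⟫_ℂ + ⟪couplingOperator ℓ ω (formWeight V m) s α U θ p, q⟫_ℂ =
      (α : ℂ) * (starRingEnd ℂ (vertex p.1) * vertex q.1) +
        ∑ j, (∫ x, energyDensity (fun x => V j x + U j x - m + s ^ 2) p.1 q.1 j x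
            ∂linkMeasure (ℓ j) +
          (θ j : ℂ) *
            (starRingEnd ℂ (evalAt j (ℓ j).toReal p.1) * evalAt j (ℓ j).toReal q.1)) := by
  have h_link : ∀ j, ∫ x, energyDensity (fun x => V j x + U j x - m + s ^ 2) p.1 q.1 j x
      ∂linkMeasure (ℓ j) =
        (∫ x, energyDensity (fun x => formWeight V m j x ^ 2 + s ^ 2) p.1 q.1 j x
          ∂linkMeasure (ℓ j)) +
        ∫ x, (U j x : ℂ) * (starRingEnd ℂ (evalAt j x p.1) * evalAt j x q.1)
          ∂linkMeasure (ℓ j) := fun j => by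
    rw [← integral_congr_ae (energyDensity_formWeight_add_ae_eq (hm j) p.1 q.1)]
    exact integral_add (integrable_energyDensity p q j)
      (integrable_mul_conj_mul (hκ.integrable_smul_squareOperator (hU j)) p q)
  rw [isSelfAdjoint_couplingOperator.isSymmetric.apply_clm, inner_couplingOperator_right hκ hU,
    inner_formDomain]
  simp only [h_link, Finset.sum_add_distrib]
  push_cast
  ring

end Energy

section Squeezing

variable {ℓ : EReal} {ε : ℝ} {W : ℝ → ℝ}

theorem integrable_squeezed (hε : ε ≠ 0) (hW : Integrable W (linkMeasure ℓ)) :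
    Integrable (squeezed ℓ ε W) (linkMeasure ℓ) :=
  ((((integrable_indicator_iff (measurableSet_link ℓ)).2 hW).comp_div hε).const_mul ε⁻¹).restrict

theorem mem_link_of_div_mem_link {x : ℝ} (hε : 0 < ε) (hε1 : ε ≤ 1) (hx : x / ε ∈ link ℓ) :
    x ∈ link ℓ := by
  have hx0 : 0 < x := (div_pos_iff_of_pos_right hε).1 hx.1
  exact ⟨hx0, (EReal.coe_le_coe_iff.2 (le_div_self hx0.le hε hε1)).trans_lt hx.2⟩

theorem mul_mem_link {x : ℝ} (hε : 0 < ε) (hε1 : ε ≤ 1) (hx : x ∈ link ℓ) : ε * x ∈ link ℓ :=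
  mem_link_of_div_mem_link hε hε1 (by rwa [mul_div_cancel_left₀ x hε.ne'])

variable {E : Type*} [NormedAddCommGroup E] [NormedSpace ℝ E]

theorem integral_squeezed_smul (hε : 0 < ε) (hε1 : ε ≤ 1) (W : ℝ → ℝ) (h : ℝ → E) :
    ∫ x, squeezed ℓ ε W x • h x ∂linkMeasure ℓ = ∫ x, W x • h (ε * x) ∂linkMeasure ℓ := by
  have h_supp : ∀ x ∉ link ℓ, squeezed ℓ ε W x • h x = 0 := fun x hx => by
    rw [squeezed, indicator_of_notMem fun h_mem => hx (mem_link_of_div_mem_link hε hε1 h_mem),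
      mul_zero, zero_smul]
  have h_scale : ∀ x, squeezed ℓ ε W x • h x =
      ε⁻¹ • (link ℓ).indicator (fun y => W y • h (ε * y)) (x / ε) := fun x => by
    rw [squeezed, mul_smul, indicator_smul_apply_left, mul_div_cancel₀ x hε.ne']
  rw [setIntegral_eq_integral_of_forall_compl_eq_zero h_supp]
  simp only [h_scale]
  rw [integral_smul, Measure.integral_comp_div, integral_indicator (measurableSet_link ℓ),
    abs_of_pos hε, inv_smul_smul₀ hε.ne']

theorem integral_abs_squeezed (hε : 0 < ε) (hε1 : ε ≤ 1) (W : ℝ → ℝ) :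
    ∫ x, |squeezed ℓ ε W x| ∂linkMeasure ℓ = ∫ x, |W x| ∂linkMeasure ℓ := by
  have h_abs : ∀ x, |squeezed ℓ ε W x| = squeezed ℓ ε (fun y => |W y|) x • (1 : ℝ) := fun x => by
    rw [squeezed, squeezed, abs_mul, abs_of_pos (inv_pos.2 hε), smul_eq_mul, mul_one]
    exact congrArg (ε⁻¹ * ·) (norm_indicator_eq_indicator_norm W (x / ε))
  simp only [h_abs]
  rw [integral_squeezed_smul hε hε1]
  simp only [smul_eq_mul, mul_one]

theorem tendsto_integral_squeezed_smul [CompleteSpace E] (hW : Integrable W (linkMeasure ℓ))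
    {g : ℝ → E} {C : ℝ} (hg : ContinuousOn g (Ici 0)) (hC : ∀ x ∈ link ℓ, ‖g x‖ ≤ C) :
    Tendsto (fun ε => ∫ x, squeezed ℓ ε W x • g x ∂linkMeasure ℓ) (𝓝[>] 0)
      (𝓝 ((∫ x, W x ∂linkMeasure ℓ) • g 0)) := by
  have h_small : ∀ᶠ ε : ℝ in 𝓝[>] 0, ε ∈ Ioc 0 1 := Ioc_mem_nhdsGT one_pos
  have h_maps : ∀ {ε : ℝ}, 0 < ε → MapsTo (fun x => ε * x) (link ℓ) (Ici 0) := fun hε _ hx =>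
    (mul_pos hε hx.1).le
  rw [← integral_smul_const]
  refine (tendsto_integral_filter_of_dominated_convergence (F := fun ε x => W x • g (ε * x))
    (fun x => |W x| * C) ?_ ?_ (hW.abs.mul_const C) ?_).congr' ?_
  · filter_upwards [h_small] with ε hε
    exact hW.aestronglyMeasurable.smul ((hg.comp (by fun_prop) (h_maps hε.1)).aestronglyMeasurable
      (measurableSet_link ℓ))
  · filter_upwards [h_small] with ε hε
    filter_upwards [ae_restrict_mem (measurableSet_link ℓ)] with x hx
    rw [norm_smul, Real.norm_eq_abs]
    exact mul_le_mul_of_nonneg_left (hC _ (mul_mem_link hε.1 hε.2 hx)) (abs_nonneg _)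
  · filter_upwards [ae_restrict_mem (measurableSet_link ℓ)] with x hx
    refine ((hg 0 self_mem_Ici).tendsto.comp ?_).const_smul (W x)
    refine tendsto_nhdsWithin_iff.2 ⟨?_, ?_⟩
    · exact tendsto_nhdsWithin_of_tendsto_nhds (by simpa using (tendsto_id (x := 𝓝 0)).mul_const x)
    · exact eventually_nhdsWithin_of_forall fun ε hε => h_maps hε hx
  · filter_upwards [h_small] with ε hε
    exact (integral_squeezed_smul hε.1 hε.2 W g).symm

end Squeezing

section Convergence

variable {N : ℕ} {ℓ : Fin N → EReal} {ω : Fin N → ℝ} {w : Fin N → ℝ → ℝ} {s κ : ℝ}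

theorem tendsto_couplingOperator_squeezed (hκ : TraceBound ℓ ω w s κ) {W : Fin N → ℝ → ℝ}
    (hW : ∀ j, Integrable (W j) (linkMeasure (ℓ j))) (θ : Fin N → ℝ) :
    Tendsto (fun ε => couplingOperator ℓ ω w s 0 (fun j => squeezed (ℓ j) ε (W j)) θ) (𝓝[>] 0)
      (𝓝 (couplingOperator ℓ ω w s (∑ j, ∫ x, W j x ∂linkMeasure (ℓ j)) 0 θ)) := by
  have h_link : ∀ j, Tendsto
      (fun ε => ∫ x, squeezed (ℓ j) ε (W j) x • squareOperator (formEval ℓ ω w s j x)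
        ∂linkMeasure (ℓ j)) (𝓝[>] 0)
      (𝓝 ((∫ x, W j x ∂linkMeasure (ℓ j)) • squareOperator (vertexEval ℓ ω w s))) := fun j => by
    rw [← formEval_zero j]
    exact tendsto_integral_squeezed_smul (hW j)
      (continuous_squareOperator.comp_continuousOn (continuousOn_formEval j))
      fun x hx => norm_squareOperator_le (hκ j x (link_subset_closedLink hx))
  have h_limit : couplingOperator ℓ ω w s (∑ j, ∫ x, W j x ∂linkMeasure (ℓ j)) 0 θ =
      ((0 : ℝ) - 1) • squareOperator (vertexEval ℓ ω w s) +
        ∑ j, ((∫ x, W j x ∂linkMeasure (ℓ j)) • squareOperator (vertexEval ℓ ω w s) +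
          θ j • squareOperator (formEval ℓ ω w s j (ℓ j).toReal)) := by
    simp only [couplingOperator, Pi.zero_apply, zero_smul, integral_zero, zero_add,
      Finset.sum_add_distrib, sub_smul, Finset.sum_smul]
    abel
  rw [h_limit]
  exact tendsto_const_nhds.add <|
    tendsto_finsetSum _ fun j _ => (h_link j).add tendsto_const_nhds

end Convergence

section TestFunction

variable {ℓ : EReal} {ω : ℝ} {f f' F p D r : ℝ → ℂ}

theorem memLp_mul_of_continuousOn_Icc {q : ENNReal} {x : ℝ} {h : ℝ → ℂ}
    (hh : MemLp h q ((linkMeasure ℓ).restrict (Ioc 0 x))) (hF : ContinuousOn F (Icc 0 x))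
    (h0 : ∀ t ∈ link ℓ, x < t → h t * F t = 0) :
    MemLp (fun t => h t * F t) q (linkMeasure ℓ) := by
  obtain ⟨C, hC⟩ := isCompact_Icc.exists_bound_of_continuousOn hF
  have h_meas : AEStronglyMeasurable F ((linkMeasure ℓ).restrict (Ioc 0 x)) :=
    (hF.mono Ioc_subset_Icc_self).aestronglyMeasurable measurableSet_Ioc
  have h_restrict : MemLp (fun t => h t * F t) q ((linkMeasure ℓ).restrict (Ioc 0 x)) := by
    refine hh.of_le_mul (c := C) (hh.aestronglyMeasurable.mul h_meas) ?_
    filter_upwards [ae_restrict_mem measurableSet_Ioc] with t ht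
    rw [norm_mul, mul_comm]
    exact mul_le_mul_of_nonneg_right (hC t (Ioc_subset_Icc_self ht)) (norm_nonneg _)
  refine (memLp_congr_ae ?_).1 ((memLp_indicator_iff_restrict measurableSet_Ioc).2 h_restrict)
  filter_upwards [ae_linkMeasure_notMem_Ioc h0] with t ht
  by_cases htx : t ∈ Ioc 0 x
  · rw [indicator_of_mem htx]
  · rw [indicator_of_notMem htx, ht htx]

theorem isFiniteMeasure_linkMeasure_restrict_Ioc (ℓ : EReal) (x y : ℝ) :
    IsFiniteMeasure ((linkMeasure ℓ).restrict (Ioc x y)) :=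
  isFiniteMeasure_restrict.2 (linkMeasure_Ioc_ne_top ℓ x y)

theorem HasLocACDeriv.memLp_restrict_Ioc (hF : HasLocACDeriv ℓ F p) {x : ℝ}
    (hx : x ∈ closedLink ℓ) : MemLp F 2 ((linkMeasure ℓ).restrict (Ioc 0 x)) := by
  have := isFiniteMeasure_linkMeasure_restrict_Ioc ℓ 0 x
  have h_cont := hF.continuousOn_Icc hx
  obtain ⟨C, hC⟩ := isCompact_Icc.exists_bound_of_continuousOn h_cont
  refine .of_bound ((h_cont.mono Ioc_subset_Icc_self).aestronglyMeasurable measurableSet_Ioc) C ?_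
  filter_upwards [ae_restrict_mem measurableSet_Ioc] with t ht using hC t (Ioc_subset_Icc_self ht)

theorem HasLocACDeriv.memLp_of_vanish (hF : HasLocACDeriv ℓ F p) {x : ℝ} (hx : x ∈ closedLink ℓ)
    (h0 : ∀ t ∈ link ℓ, x < t → F t = 0) : MemLp F 2 (linkMeasure ℓ) := by
  have := isFiniteMeasure_linkMeasure_restrict_Ioc ℓ 0 x
  simpa only [one_mul] using memLp_mul_of_continuousOn_Icc (memLp_const (1 : ℂ))
    (hF.continuousOn_Icc hx) (by simpa only [one_mul] using h0)

theorem HasLocACDeriv.memLp_sqrt_mul_of_vanish (hF : HasLocACDeriv ℓ F p) {x : ℝ}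
    (hx : x ∈ closedLink ℓ) (h0 : ∀ t ∈ link ℓ, x < t → F t = 0) {V : ℝ → ℝ}
    (hV : LocallyIntegrableOn V (closedLink ℓ) volume) (m : ℝ) :
    MemLp (fun t => (√(V t - m) : ℂ) * F t) 2 (linkMeasure ℓ) := by
  have := isFiniteMeasure_linkMeasure_restrict_Ioc ℓ 0 x
  have h_int : Integrable (fun t => V t - m) ((linkMeasure ℓ).restrict (Ioc 0 x)) := by
    rw [restrict_linkMeasure_Ioc le_rfl hx]
    exact ((hV.integrableOn_compact_subset (Icc_subset_closedLink hx) isCompact_Icc).mono_set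
      Ioc_subset_Icc_self).sub (integrableOn_const measure_Ioc_lt_top.ne)
  have h_sqrt : MemLp (fun t => √(V t - m)) 2 ((linkMeasure ℓ).restrict (Ioc 0 x)) := by
    rw [memLp_two_iff_integrable_sq
      (Real.continuous_sqrt.comp_aestronglyMeasurable h_int.aestronglyMeasurable)]
    simpa only [Real.sq_sqrt'] using h_int.pos_part
  exact memLp_mul_of_continuousOn_Icc h_sqrt.ofReal (hF.continuousOn_Icc hx) fun t ht hxt => by
    rw [h0 t ht hxt, mul_zero]

theorem hasLocACDeriv_integral (h : ∀ x ∈ closedLink ℓ, IntervalIntegrable f' volume 0 x) (k : ℂ) :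
    HasLocACDeriv ℓ (fun x => k + ∫ t in (0 : ℝ)..x, f' t) f' := fun x hx =>
  ⟨h x hx, by simp only [intervalIntegral.integral_same, add_zero]⟩

/-- `f`, with derivative `f'`, is a test function on a link for the boundary condition given by `ω`:
it has finite energy, vanishes far out, and satisfies the boundary condition at the end of the link
if that is a Dirichlet condition. -/
structure IsTestFunction (ℓ : EReal) (ω : ℝ) (f f' : ℝ → ℂ) : Prop where
  hasLocACDeriv : HasLocACDeriv ℓ f f'
  memLp_deriv : MemLp f' 2 (linkMeasure ℓ)
  exists_vanish : ∃ x ∈ closedLink ℓ, ∀ t ∈ link ℓ, x < t → f t = 0 ∧ f' t = 0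
  eq_zero_of_sin_eq_zero : ∀ b : ℝ, ℓ = b → Real.sin ω = 0 → f b = 0

theorem IsTestFunction.zero (hℓ : 0 < ℓ) : IsTestFunction ℓ ω 0 0 :=
  ⟨HasLocACDeriv.zero ℓ, MemLp.zero, ⟨0, zero_mem_closedLink hℓ, fun _ _ _ => ⟨rfl, rfl⟩⟩,
    fun _ _ _ => rfl⟩

theorem IsTestFunction.memLp (hf : IsTestFunction ℓ ω f f') : MemLp f 2 (linkMeasure ℓ) := by
  obtain ⟨x, hx, h0⟩ := hf.exists_vanish
  exact hf.hasLocACDeriv.memLp_of_vanish hx fun t ht hxt => (h0 t ht hxt).1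

theorem IsTestFunction.memLp_sqrt_mul (hf : IsTestFunction ℓ ω f f') {V : ℝ → ℝ}
    (hV : LocallyIntegrableOn V (closedLink ℓ) volume) (m : ℝ) :
    MemLp (fun t => (√(V t - m) : ℂ) * f t) 2 (linkMeasure ℓ) := by
  obtain ⟨x, hx, h0⟩ := hf.exists_vanish
  exact hf.hasLocACDeriv.memLp_sqrt_mul_of_vanish hx (fun t ht hxt => (h0 t ht hxt).1) hV m

theorem HasLocACDeriv.intervalIntegral_conj_mul (hD : HasLocACDeriv ℓ D r)
    (hF : HasLocACDeriv ℓ F p) {x : ℝ} (hx : x ∈ closedLink ℓ) :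
    IntervalIntegrable (fun t => starRingEnd ℂ (D t) * p t + starRingEnd ℂ (r t) * F t) volume 0 x ∧
      ∫ t in (0 : ℝ)..x, (starRingEnd ℂ (D t) * p t + starRingEnd ℂ (r t) * F t) =
        starRingEnd ℂ (D x) * F x - starRingEnd ℂ (D 0) * F 0 := by
  obtain ⟨h_int, h_eq⟩ := hD.conj.mul hF x hx
  simp only [add_comm (starRingEnd ℂ (r _) * F _)] at h_int h_eq
  exact ⟨h_int, eq_sub_of_add_eq' h_eq.symm⟩

theorem IsTestFunction.exists_endpoint (hf : IsTestFunction ℓ ω f f') (hℓ : 0 < ℓ) (D : ℝ → ℂ) :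
    ∃ x ∈ closedLink ℓ, (∀ t ∈ link ℓ, x < t → f t = 0 ∧ f' t = 0) ∧
      starRingEnd ℂ (D x) * f x =
        if ℓ = ⊤ then 0 else starRingEnd ℂ (D ℓ.toReal) * f ℓ.toReal := by
  rcases eq_or_ne ℓ ⊤ with rfl | h_top
  · obtain ⟨x, hx, h0⟩ := hf.exists_vanish
    have h_link : x + 1 ∈ link ⊤ := ⟨by linarith [hx.1], EReal.coe_lt_top _⟩
    exact ⟨x + 1, link_subset_closedLink h_link, fun t ht hxt => h0 t ht (by linarith),
      by rw [(h0 _ h_link (lt_add_one x)).1, mul_zero, if_pos rfl]⟩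
  · refine ⟨ℓ.toReal, toReal_mem_closedLink hℓ, fun t ht hxt => ?_, by rw [if_neg h_top]⟩
    exact absurd ht.2 (((EReal.coe_toReal h_top hℓ.ne_bot).symm.trans_lt
      (EReal.coe_lt_coe_iff.2 hxt)).not_gt)

theorem IsTestFunction.integral_conj_mul (hf : IsTestFunction ℓ ω f f') (hℓ : 0 < ℓ)
    (hD : HasLocACDeriv ℓ D r) :
    Integrable (fun t => starRingEnd ℂ (D t) * f' t + starRingEnd ℂ (r t) * f t) (linkMeasure ℓ) ∧
      ∫ t, (starRingEnd ℂ (D t) * f' t + starRingEnd ℂ (r t) * f t) ∂linkMeasure ℓ =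
        (if ℓ = ⊤ then 0 else starRingEnd ℂ (D ℓ.toReal) * f ℓ.toReal) -
          starRingEnd ℂ (D 0) * f 0 := by
  obtain ⟨x, hx, h0, h_end⟩ := hf.exists_endpoint hℓ D
  have h_vanish : ∀ t ∈ link ℓ, x < t →
      starRingEnd ℂ (D t) * f' t + starRingEnd ℂ (r t) * f t = 0 := fun t ht hxt => by
    rw [(h0 t ht hxt).1, (h0 t ht hxt).2, mul_zero, mul_zero, add_zero]
  obtain ⟨h_int, h_eq⟩ := hD.intervalIntegral_conj_mul hf.hasLocACDeriv hx
  exact ⟨integrable_linkMeasure_of_intervalIntegrable hx h_int h_vanish,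
    by rw [integral_linkMeasure_eq_intervalIntegral hx h_vanish, h_eq, h_end]⟩

end TestFunction

theorem ae_eq_average_of_integral_conj_mul_eq_zero {X : Type*} [MeasurableSpace X] {μ : Measure X}
    [IsFiniteMeasure μ] {h : X → ℂ} (hh : MemLp h 2 μ)
    (h0 : ∫ x, starRingEnd ℂ (h x) * (h x - ⨍ y, h y ∂μ) ∂μ = 0) :
    ∀ᵐ x ∂μ, h x = ⨍ y, h y ∂μ := by
  set M := ⨍ y, h y ∂μ
  have h_memLp : MemLp (fun x => h x - M) 2 μ := hh.sub (memLp_const M)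
  have h_mean : ∫ x, (h x - M) ∂μ = 0 := integral_sub_average μ h
  have h_sq : ∫ x, ((‖h x - M‖ ^ 2 : ℝ) : ℂ) ∂μ = 0 := calc
    ∫ x, ((‖h x - M‖ ^ 2 : ℝ) : ℂ) ∂μ
      = ∫ x, (starRingEnd ℂ (h x) * (h x - M) - starRingEnd ℂ M * (h x - M)) ∂μ := by
        simp only [← Complex.normSq_eq_norm_sq, Complex.normSq_eq_conj_mul_self, ← sub_mul,
          ← map_sub]
    _ = 0 := by
        have h_int : Integrable (fun x => starRingEnd ℂ (h x) * (h x - M)) μ :=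
          hh.star.integrable_mul h_memLp
        rw [integral_sub h_int ((h_memLp.integrable one_le_two).const_mul _), h0,
          integral_const_mul, h_mean, mul_zero, sub_zero]
  rw [integral_complex_ofReal, Complex.ofReal_eq_zero, integral_eq_zero_iff_of_nonneg
    (fun _ => sq_nonneg _) (h_memLp.integrable_norm_pow two_ne_zero)] at h_sq
  filter_upwards [h_sq] with x hx
  exact sub_eq_zero.1 (norm_eq_zero.1 (sq_eq_zero_iff.1 hx))

theorem exists_ae_linkMeasure_eq_const {X : Type*} {ℓ : EReal} (hℓ : 0 < ℓ) {h : ℝ → X}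
    (hh : ∀ x ∈ link ℓ, ∃ k, ∀ᵐ t ∂volume.restrict (Ioc 0 x), h t = k) :
    ∃ k, ∀ᵐ t ∂linkMeasure ℓ, h t = k := by
  obtain ⟨y, hy⟩ : ∃ y : ℝ, y ∈ link ℓ := by
    obtain ⟨y, h0y, hyℓ⟩ := EReal.lt_iff_exists_real_btwn.1 hℓ
    exact ⟨y, EReal.coe_pos.1 h0y, hyℓ⟩
  obtain ⟨k, hk⟩ := hh y hy
  refine ⟨k, ae_linkMeasure_of_ae_Ioo fun x hx => ?_⟩
  obtain ⟨k', hk'⟩ := hh x hx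
  have h_eq : k = k' := by
    have h_ne : NeBot (ae (volume.restrict (Ioc 0 (min x y)))) := by
      rw [ae_restrict_neBot, Real.volume_Ioc, sub_zero]
      exact (ENNReal.ofReal_pos.2 (lt_min hx.1 hy.1)).ne'
    obtain ⟨t, ht, ht'⟩ := ((ae_restrict_of_ae_restrict_of_subset
      (Ioc_subset_Ioc_right (min_le_right x y)) hk).and (ae_restrict_of_ae_restrict_of_subset
      (Ioc_subset_Ioc_right (min_le_left x y)) hk')).exists
    exact ht.symm.trans ht'
  filter_upwards [(ae_restrict_iff' measurableSet_Ioc).1 hk'] with t ht htx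
  rw [h_eq, ht (Ioo_subset_Ioc_self htx)]

section WeakSolution

/-- The coefficient `cot ω` of the end term `cot ω |ψ(ℓ)|²` of the energy form of a link. It is `0`
on infinite links, and also for Dirichlet conditions `sin ω = 0`, by the convention `x / 0 = 0`. -/
def endCoeff (ℓ : EReal) (ω : ℝ) : ℝ :=
  if ℓ = ⊤ then 0 else Real.cos ω / Real.sin ω

theorem endCoeff_mul_eq_zero {ℓ : EReal} (hℓ : 0 < ℓ) (ω : ℝ) {f : ℝ → ℂ}
    (hf : ∀ b : ℝ, ℓ = b → f b = 0) (z : ℂ) :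
    (endCoeff ℓ ω : ℂ) * (z * f ℓ.toReal) = 0 := by
  rcases eq_or_ne ℓ ⊤ with h_top | h_top
  · rw [endCoeff, if_pos h_top, Complex.ofReal_zero, zero_mul]
  · rw [hf _ (EReal.coe_toReal h_top hℓ.ne_bot).symm, mul_zero, mul_zero]

variable {N : ℕ} {ℓ : Fin N → EReal} {ω : Fin N → ℝ} {α : ℝ} {F b r : Fin N → ℝ → ℂ} {c : ℂ}

/-- The functions `F j`, with derivatives `b j` and value `c` at the vertex, solve `F j'' = r j`
weakly, with coupling `α` at the vertex and the boundary conditions given by `ω`. -/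
def IsWeakSolution (ℓ : Fin N → EReal) (ω : Fin N → ℝ) (α : ℝ) (F b r : Fin N → ℝ → ℂ) (c : ℂ) :
    Prop :=
  ∀ (f f' : Fin N → ℝ → ℂ) (c' : ℂ), (∀ j, IsTestFunction (ℓ j) (ω j) (f j) (f' j)) →
    (∀ j, f j 0 = c') →
    (α : ℂ) * (starRingEnd ℂ c * c') +
      ∑ j, (∫ t, (starRingEnd ℂ (b j t) * f' j t + starRingEnd ℂ (r j t) * f j t)
          ∂linkMeasure (ℓ j) +
        (endCoeff (ℓ j) (ω j) : ℂ) *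
          (starRingEnd ℂ (F j (ℓ j).toReal) * f j (ℓ j).toReal)) = 0

theorem IsWeakSolution.congr_ae (h : IsWeakSolution ℓ ω α F b r c) {D : Fin N → ℝ → ℂ}
    (hD : ∀ j, b j =ᵐ[linkMeasure (ℓ j)] D j) : IsWeakSolution ℓ ω α F D r c := by
  intro f f' c' hf hc'
  rw [← h f f' c' hf hc']
  refine congrArg _ (Finset.sum_congr rfl fun j _ => congrArg (· + _) (integral_congr_ae ?_))
  filter_upwards [hD j] with t ht
  rw [ht]

theorem IsWeakSolution.single (h : IsWeakSolution ℓ ω α F b r c) (hℓ : ∀ j, 0 < ℓ j) {j : Fin N}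
    {f f' : ℝ → ℂ} (hf : IsTestFunction (ℓ j) (ω j) f f') (hf0 : f 0 = 0) :
    ∫ t, (starRingEnd ℂ (b j t) * f' t + starRingEnd ℂ (r j t) * f t) ∂linkMeasure (ℓ j) +
      (endCoeff (ℓ j) (ω j) : ℂ) * (starRingEnd ℂ (F j (ℓ j).toReal) * f (ℓ j).toReal) = 0 := by
  have h_weak := h (Pi.single j f) (Pi.single j f') 0
    (fun i => by
      rcases eq_or_ne i j with rfl | hi
      · rwa [Pi.single_eq_same, Pi.single_eq_same]
      · rw [Pi.single_eq_of_ne hi, Pi.single_eq_of_ne hi]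
        exact .zero (hℓ i))
    (fun i => by
      rcases eq_or_ne i j with rfl | hi
      · rwa [Pi.single_eq_same]
      · rw [Pi.single_eq_of_ne hi, Pi.zero_apply])
  rw [mul_zero, mul_zero, zero_add, Finset.sum_eq_single_of_mem j (Finset.mem_univ j)
    (fun i _ hi => by
      simp only [Pi.single_eq_of_ne hi, Pi.zero_apply, mul_zero, add_zero, integral_zero]),
    Pi.single_eq_same, Pi.single_eq_same] at h_weak
  exact h_weak

theorem intervalIntegral_indicator_eq_zero {η : ℝ → ℂ} {x u : ℝ} (hx : 0 ≤ x) (hxu : x ≤ u)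
    (h0 : ∫ t in Ioc 0 x, η t = 0) : ∫ t in (0 : ℝ)..u, (Ioc 0 x).indicator η t = 0 := by
  rw [intervalIntegral.integral_of_le (hx.trans hxu), setIntegral_indicator measurableSet_Ioc,
    inter_eq_right.2 (Ioc_subset_Ioc_right hxu), h0]

theorem isTestFunction_integral_indicator {ℓ : EReal} (ω : ℝ) {η : ℝ → ℂ} {x : ℝ}
    (hx : x ∈ closedLink ℓ) (hη : MemLp η 2 (volume.restrict (Ioc 0 x)))
    (h0 : ∫ t in Ioc 0 x, η t = 0) :
    IsTestFunction ℓ ω (fun u => ∫ t in (0 : ℝ)..u, (Ioc 0 x).indicator η t)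
      ((Ioc 0 x).indicator η) where
  hasLocACDeriv := by
    have h_int : Integrable ((Ioc 0 x).indicator η) :=
      (integrable_indicator_iff measurableSet_Ioc).2 (hη.integrable one_le_two)
    simpa only [zero_add] using hasLocACDeriv_integral (fun u _ => h_int.intervalIntegrable) 0
  memLp_deriv := by
    rwa [memLp_indicator_iff_restrict measurableSet_Ioc, restrict_linkMeasure_Ioc le_rfl hx]
  exists_vanish := ⟨x, hx, fun t _ hxt => ⟨intervalIntegral_indicator_eq_zero hx.1 hxt.le h0,
    indicator_of_notMem (fun ht => ht.2.not_gt hxt) η⟩⟩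
  eq_zero_of_sin_eq_zero b hb _ := intervalIntegral_indicator_eq_zero hx.1
    (EReal.coe_le_coe_iff.1 (hx.2.trans_eq hb)) h0

theorem IsWeakSolution.integral_conj_sub_mul_eq_zero (h : IsWeakSolution ℓ ω α F b r c)
    (hℓ : ∀ j, 0 < ℓ j) {j : Fin N} {G : ℝ → ℂ} (hG : HasLocACDeriv (ℓ j) G (r j)) {x : ℝ}
    (hx : x ∈ closedLink (ℓ j)) (hbG : MemLp (fun t => b j t - G t) 2 (volume.restrict (Ioc 0 x)))
    {η : ℝ → ℂ} (hη : MemLp η 2 (volume.restrict (Ioc 0 x))) (h0 : ∫ t in Ioc 0 x, η t = 0) :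
    ∫ t in Ioc 0 x, starRingEnd ℂ (b j t - G t) * η t = 0 := by
  have h_test := isTestFunction_integral_indicator (ω j) hx hη h0
  set f' := (Ioc 0 x).indicator η
  set f : ℝ → ℂ := fun u => ∫ t in (0 : ℝ)..u, f' t
  have hf_zero : f 0 = 0 := intervalIntegral.integral_same
  have hf_end : ∀ e : ℝ, ℓ j = e → f e = 0 := fun e he =>
    intervalIntegral_indicator_eq_zero hx.1 (EReal.coe_le_coe_iff.1 (hx.2.trans_eq he)) h0
  have hb_weak := h.single hℓ h_test hf_zero
  rw [endCoeff_mul_eq_zero (hℓ j) (ω j) hf_end, add_zero] at hb_weak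
  obtain ⟨hG_int, hG_weak⟩ := h_test.integral_conj_mul (hℓ j) hG
  have hG_zero : (if ℓ j = ⊤ then 0 else starRingEnd ℂ (G (ℓ j).toReal) * f (ℓ j).toReal) = 0 := by
    split_ifs with h_top
    · rfl
    · rw [hf_end _ (EReal.coe_toReal h_top (hℓ j).ne_bot).symm, mul_zero]
  have h_indicator : (fun t => starRingEnd ℂ (b j t - G t) * f' t) =
      (Ioc 0 x).indicator fun t => starRingEnd ℂ (b j t - G t) * η t :=
    funext fun t => (indicator_mul_right _ (fun t => starRingEnd ℂ (b j t - G t)) η).symm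
  have h_int : Integrable (fun t => starRingEnd ℂ (b j t - G t) * f' t) (linkMeasure (ℓ j)) := by
    rw [h_indicator, integrable_indicator_iff measurableSet_Ioc, IntegrableOn,
      restrict_linkMeasure_Ioc le_rfl hx]
    exact hbG.star.integrable_mul hη
  calc ∫ t in Ioc 0 x, starRingEnd ℂ (b j t - G t) * η t
      = ∫ t, starRingEnd ℂ (b j t - G t) * f' t ∂linkMeasure (ℓ j) := by
        rw [h_indicator, integral_indicator measurableSet_Ioc, restrict_linkMeasure_Ioc le_rfl hx]
    _ = ∫ t, (starRingEnd ℂ (b j t - G t) * f' t +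
          (starRingEnd ℂ (G t) * f' t + starRingEnd ℂ (r j t) * f t)) ∂linkMeasure (ℓ j) := by
        rw [integral_add h_int hG_int, hG_weak, hG_zero, hf_zero, mul_zero, sub_zero, add_zero]
    _ = 0 := by
        rw [← hb_weak]
        simp only [map_sub, sub_mul, ← add_assoc, sub_add_cancel]

/-- The du Bois-Reymond argument: `b j - G` is orthogonal to the functions of mean zero. -/
theorem IsWeakSolution.sub_ae_eq_average (h : IsWeakSolution ℓ ω α F b r c) (hℓ : ∀ j, 0 < ℓ j)
    {j : Fin N} (hb : MemLp (b j) 2 (linkMeasure (ℓ j))) {G : ℝ → ℂ}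
    (hG : HasLocACDeriv (ℓ j) G (r j)) {x : ℝ} (hx : x ∈ closedLink (ℓ j)) :
    ∀ᵐ t ∂volume.restrict (Ioc 0 x), b j t - G t = ⨍ u in Ioc 0 x, (b j u - G u) := by
  have hG_memLp : MemLp G 2 (volume.restrict (Ioc 0 x)) :=
    restrict_linkMeasure_Ioc le_rfl hx ▸ hG.memLp_restrict_Ioc hx
  have hbG : MemLp (fun t => b j t - G t) 2 (volume.restrict (Ioc 0 x)) :=
    (restrict_linkMeasure_Ioc le_rfl hx ▸ hb.restrict (Ioc 0 x)).sub hG_memLp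
  exact ae_eq_average_of_integral_conj_mul_eq_zero hbG <| h.integral_conj_sub_mul_eq_zero hℓ hG hx
    hbG (hbG.sub (memLp_const _)) (integral_sub_average _ _)

theorem IsWeakSolution.exists_hasLocACDeriv (h : IsWeakSolution ℓ ω α F b r c)
    (hℓ : ∀ j, 0 < ℓ j) {j : Fin N} (hb : MemLp (b j) 2 (linkMeasure (ℓ j)))
    (hr : ∀ x ∈ closedLink (ℓ j), IntervalIntegrable (r j) volume 0 x) :
    ∃ D, HasLocACDeriv (ℓ j) D (r j) ∧ b j =ᵐ[linkMeasure (ℓ j)] D := by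
  have hG : HasLocACDeriv (ℓ j) (fun x => ∫ t in (0 : ℝ)..x, r j t) (r j) := by
    simpa only [zero_add] using hasLocACDeriv_integral hr 0
  obtain ⟨k, hk⟩ := exists_ae_linkMeasure_eq_const (hℓ j) fun x hx =>
    ⟨_, h.sub_ae_eq_average hℓ hb hG (link_subset_closedLink hx)⟩
  refine ⟨fun x => k + ∫ t in (0 : ℝ)..x, r j t, hasLocACDeriv_integral hr k, ?_⟩
  filter_upwards [hk] with t ht
  exact sub_eq_iff_eq_add.1 ht

end WeakSolution

section Cutoff

/-- The derivative of `cutoff`. -/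
def cutoffDeriv (a : ℝ) : ℝ → ℝ := (Ioc a (2 * a)).indicator fun _ => -a⁻¹

/-- The cutoff function on `[0, ∞)` which is equal to `1` on `[0, a]` and to `0` on `[2a, ∞)`, and
affine in between. -/
def cutoff (a x : ℝ) : ℝ := 1 + ∫ t in (0 : ℝ)..x, cutoffDeriv a t

variable {a x : ℝ}

theorem cutoff_eq_sub (ha : 0 < a) (hx : 0 ≤ x) :
    cutoff a x = 1 - a⁻¹ * max (min x (2 * a) - a) 0 := by
  rw [cutoff, cutoffDeriv, intervalIntegral.integral_of_le hx,
    setIntegral_indicator measurableSet_Ioc, setIntegral_const, Ioc_inter_Ioc, max_eq_right ha.le,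
    Real.volume_real_Ioc, smul_eq_mul, mul_neg, mul_comm, ← sub_eq_add_neg]

theorem cutoff_zero (a : ℝ) : cutoff a 0 = 1 := by
  rw [cutoff, intervalIntegral.integral_same, add_zero]

theorem cutoff_of_le (hx : 0 ≤ x) (ha : 0 < a) (hxa : x ≤ a) : cutoff a x = 1 := by
  rw [cutoff_eq_sub ha hx, max_eq_right (by linarith [min_le_left x (2 * a)]), mul_zero, sub_zero]

theorem cutoff_of_ge (ha : 0 < a) (hx : 2 * a ≤ x) : cutoff a x = 0 := by
  rw [cutoff_eq_sub ha (by linarith), min_eq_right hx, max_eq_left (by linarith), two_mul,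
    add_sub_cancel_right, inv_mul_cancel₀ ha.ne', sub_self]

theorem cutoffDeriv_of_gt (hx : 2 * a < x) : cutoffDeriv a x = 0 :=
  indicator_of_notMem (fun h => h.2.not_gt hx) _

theorem sq_cutoffDeriv_le (a x : ℝ) : cutoffDeriv a x ^ 2 ≤ (a ^ 2)⁻¹ := by
  rw [cutoffDeriv, indicator_apply]
  split_ifs
  · rw [neg_sq, inv_pow]
  · rw [zero_pow two_ne_zero]
    positivity

variable {ℓ : EReal}

theorem memLp_cutoffDeriv (ℓ : EReal) (a : ℝ) :
    MemLp (fun t => (cutoffDeriv a t : ℂ)) 2 (linkMeasure ℓ) :=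
  MemLp.ofReal (memLp_indicator_const 2 measurableSet_Ioc (-a⁻¹)
    (Or.inr (linkMeasure_Ioc_ne_top ℓ a (2 * a))))

theorem hasLocACDeriv_cutoff (ℓ : EReal) (a : ℝ) :
    HasLocACDeriv ℓ (fun x => (cutoff a x : ℂ)) (fun x => (cutoffDeriv a x : ℂ)) := by
  have h_int : Integrable (cutoffDeriv a) :=
    (integrable_indicator_iff measurableSet_Ioc).2 (integrableOn_const measure_Ioc_lt_top.ne)
  simpa only [cutoff, Complex.ofReal_add, Complex.ofReal_one, intervalIntegral.integral_ofReal]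
    using hasLocACDeriv_integral (ℓ := ℓ) (f' := fun x => (cutoffDeriv a x : ℂ))
      (fun x _ => h_int.ofReal.intervalIntegrable) 1

theorem exists_mem_closedLink_forall_lt (hℓ : 0 < ℓ) (hx : 0 ≤ x) :
    ∃ y ∈ closedLink ℓ, ∀ t ∈ link ℓ, y < t → x < t := by
  by_cases hxℓ : x ∈ closedLink ℓ
  · exact ⟨x, hxℓ, fun _ _ h => h⟩
  · have h_lt : ℓ < x := not_le.1 fun h => hxℓ ⟨hx, h⟩
    refine ⟨ℓ.toReal, toReal_mem_closedLink hℓ, fun t ht hty => absurd ht.2 ?_⟩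
    rw [← EReal.coe_toReal h_lt.ne_top hℓ.ne_bot, EReal.coe_lt_coe_iff]
    exact hty.not_gt

theorem isTestFunction_cutoff_mul {ω : ℝ} {F p : ℝ → ℂ} (hℓ : 0 < ℓ) (ha : 0 < a)
    (hF : HasLocACDeriv ℓ F p)
    (hp : ∀ x ∈ closedLink ℓ, MemLp p 2 ((linkMeasure ℓ).restrict (Ioc 0 x)))
    (hD : ∀ b : ℝ, ℓ = b → Real.sin ω = 0 → cutoff a b * F b = 0) :
    IsTestFunction ℓ ω (fun x => cutoff a x * F x)
      (fun x => cutoffDeriv a x * F x + cutoff a x * p x) := by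
  obtain ⟨y, hy, h_gt⟩ := exists_mem_closedLink_forall_lt hℓ (mul_nonneg zero_le_two ha.le)
  have hχ : ∀ t ∈ link ℓ, y < t → (cutoff a t : ℂ) = 0 := fun t ht hyt => by
    rw [cutoff_of_ge ha (h_gt t ht hyt).le, Complex.ofReal_zero]
  have hχ' : ∀ t ∈ link ℓ, y < t → (cutoffDeriv a t : ℂ) = 0 := fun t ht hyt => by
    rw [cutoffDeriv_of_gt (h_gt t ht hyt), Complex.ofReal_zero]
  refine ⟨(hasLocACDeriv_cutoff ℓ a).mul hF, .add ?_ ?_, ⟨y, hy, fun t ht hyt => ?_⟩, hD⟩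
  · exact memLp_mul_of_continuousOn_Icc ((memLp_cutoffDeriv ℓ a).restrict _)
      (hF.continuousOn_Icc hy) fun t ht hyt => by rw [hχ' t ht hyt, zero_mul]
  · simp only [mul_comm (cutoff a _ : ℂ)]
    exact memLp_mul_of_continuousOn_Icc (hp y hy) ((hasLocACDeriv_cutoff ℓ a).continuousOn_Icc hy)
      fun t ht hyt => by rw [hχ t ht hyt, mul_zero]
  · rw [hχ t ht hyt, hχ' t ht hyt, zero_mul, zero_mul, add_zero]
    exact ⟨rfl, rfl⟩

end Cutoff

section StrongSolution

variable {N : ℕ} {ℓ : Fin N → EReal} {ω : Fin N → ℝ} {α : ℝ} {F D r : Fin N → ℝ → ℂ} {c : ℂ}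

theorem isTestFunction_cutoff {ℓ : EReal} {a : ℝ} (ω : ℝ) (ha : 0 < a) (h2a : 2 * a ∈ link ℓ) :
    IsTestFunction ℓ ω (fun x => cutoff a x) (fun x => cutoffDeriv a x) where
  hasLocACDeriv := hasLocACDeriv_cutoff ℓ a
  memLp_deriv := memLp_cutoffDeriv ℓ a
  exists_vanish := ⟨2 * a, link_subset_closedLink h2a, fun t _ hat =>
    ⟨by rw [cutoff_of_ge ha hat.le, Complex.ofReal_zero],
      by rw [cutoffDeriv_of_gt hat, Complex.ofReal_zero]⟩⟩
  eq_zero_of_sin_eq_zero b hb _ := by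
    rw [cutoff_of_ge ha (EReal.coe_lt_coe_iff.1 (h2a.2.trans_eq hb)).le, Complex.ofReal_zero]

theorem isWeakSolution_iff_boundary (hℓ : ∀ j, 0 < ℓ j)
    (hD : ∀ j, HasLocACDeriv (ℓ j) (D j) (r j)) :
    IsWeakSolution ℓ ω α F D r c ↔
      ∀ (f f' : Fin N → ℝ → ℂ) (c' : ℂ), (∀ j, IsTestFunction (ℓ j) (ω j) (f j) (f' j)) →
        (∀ j, f j 0 = c') →
        ((α : ℂ) * starRingEnd ℂ c - ∑ j, starRingEnd ℂ (D j 0)) * c' +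
          ∑ j, ((if ℓ j = ⊤ then 0 else starRingEnd ℂ (D j (ℓ j).toReal)) +
            endCoeff (ℓ j) (ω j) * starRingEnd ℂ (F j (ℓ j).toReal)) * f j (ℓ j).toReal = 0 := by
  refine forall₅_congr fun f f' c' hf hc' => ?_
  simp only [((hf _).integral_conj_mul (hℓ _) (hD _)).2, hc', sub_mul, Finset.sum_mul, add_mul,
    ite_mul, zero_mul, Finset.sum_add_distrib, Finset.sum_sub_distrib, mul_assoc]
  rw [sub_add_eq_add_sub, sub_add_eq_add_sub, add_sub_assoc, add_sub_assoc, add_sub_assoc]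

theorem IsWeakSolution.vertex_condition (h : IsWeakSolution ℓ ω α F D r c) (hℓ : ∀ j, 0 < ℓ j)
    (hD : ∀ j, HasLocACDeriv (ℓ j) (D j) (r j)) : ∑ j, D j 0 = (α : ℂ) * c := by
  have h_pos : ∀ j, ∃ a : ℝ, 0 < a ∧ 2 * a ∈ link (ℓ j) := fun j => by
    obtain ⟨y, h0y, hyℓ⟩ := EReal.lt_iff_exists_real_btwn.1 (hℓ j)
    have hy : 0 < y := EReal.coe_pos.1 h0y
    exact ⟨y / 2, half_pos hy, by rwa [mul_div_cancel₀ y two_ne_zero], by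
      rwa [mul_div_cancel₀ y two_ne_zero]⟩
  choose a ha h2a using h_pos
  have h_boundary := (isWeakSolution_iff_boundary hℓ hD).1 h _ _ 1
    (fun j => isTestFunction_cutoff (ω j) (ha j) (h2a j))
    (fun j => by rw [cutoff_zero, Complex.ofReal_one])
  have h_end : ∀ j, ((if ℓ j = ⊤ then 0 else starRingEnd ℂ (D j (ℓ j).toReal)) +
      endCoeff (ℓ j) (ω j) * starRingEnd ℂ (F j (ℓ j).toReal)) * cutoff (a j) (ℓ j).toReal = 0 := by
    intro j
    rcases eq_or_ne (ℓ j) ⊤ with h_top | h_top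
    · rw [if_pos h_top, endCoeff, if_pos h_top, Complex.ofReal_zero, zero_mul, add_zero, zero_mul]
    · have h_lt := (h2a j).2
      rw [← EReal.coe_toReal h_top (hℓ j).ne_bot, EReal.coe_lt_coe_iff] at h_lt
      rw [cutoff_of_ge (ha j) h_lt.le, Complex.ofReal_zero, mul_zero]
  rw [Finset.sum_eq_zero fun j _ => h_end j, add_zero, mul_one, sub_eq_zero] at h_boundary
  simpa only [map_mul, map_sum, Complex.conj_conj, Complex.conj_ofReal] using
    (congrArg (starRingEnd ℂ) h_boundary).symm

theorem isTestFunction_ofReal {b : ℝ} (hb : 0 < b) {ω : ℝ} (hω : Real.sin ω ≠ 0) :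
    IsTestFunction b ω (fun t => (t : ℂ)) (fun _ => 1) := by
  have h_subset : link b ⊆ Ioc 0 b := fun t ht => ⟨ht.1, (EReal.coe_lt_coe_iff.1 ht.2).le⟩
  have h_finite : IsFiniteMeasure (linkMeasure b) :=
    isFiniteMeasure_restrict.2 ((measure_mono h_subset).trans_lt measure_Ioc_lt_top).ne
  exact ⟨hasLocACDeriv_of_hasDerivAt (fun t => Complex.ofRealCLM.hasDerivAt) continuous_const,
    memLp_const 1, ⟨b, ⟨hb.le, le_rfl⟩, fun t ht hbt => absurd (h_subset ht).2 hbt.not_ge⟩,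
    fun _ _ h => absurd h hω⟩

theorem IsWeakSolution.end_condition (h : IsWeakSolution ℓ ω α F D r c) (hℓ : ∀ j, 0 < ℓ j)
    {j : Fin N} (hD : HasLocACDeriv (ℓ j) (D j) (r j)) {b : ℝ} (hb : ℓ j = b)
    (hF : Real.sin (ω j) = 0 → F j b = 0) :
    F j b * (Real.cos (ω j) : ℂ) + D j b * (Real.sin (ω j) : ℂ) = 0 := by
  by_cases hω : Real.sin (ω j) = 0
  · rw [hF hω, hω, Complex.ofReal_zero, zero_mul, mul_zero, add_zero]
  have hb_pos : 0 < b := EReal.coe_pos.1 (hb ▸ hℓ j)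
  have h_test : IsTestFunction (ℓ j) (ω j) (fun t => (t : ℂ)) (fun _ => 1) :=
    hb ▸ isTestFunction_ofReal hb_pos hω
  have h_weak := h.single hℓ h_test Complex.ofReal_zero
  rw [(h_test.integral_conj_mul (hℓ j) hD).2, hb, EReal.toReal_coe, endCoeff,
    if_neg (EReal.coe_ne_top b), if_neg (EReal.coe_ne_top b), Complex.ofReal_zero, mul_zero,
    sub_zero, ← mul_assoc, ← add_mul, mul_eq_zero,
    or_iff_left (Complex.ofReal_ne_zero.2 hb_pos.ne'), Complex.ofReal_div] at h_weak
  have h_conj := congrArg (starRingEnd ℂ) h_weak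
  have hω' : (Real.sin (ω j) : ℂ) ≠ 0 := Complex.ofReal_ne_zero.2 hω
  simp only [map_add, map_mul, map_div₀, Complex.conj_conj, Complex.conj_ofReal, map_zero] at h_conj
  field_simp at h_conj
  linear_combination h_conj

theorem isWeakSolution_of_boundary_conditions (hℓ : ∀ j, 0 < ℓ j)
    (hD : ∀ j, HasLocACDeriv (ℓ j) (D j) (r j)) (h_vertex : ∑ j, D j 0 = (α : ℂ) * c)
    (h_end : ∀ j, ∀ b : ℝ, ℓ j = b →
      F j b * (Real.cos (ω j) : ℂ) + D j b * (Real.sin (ω j) : ℂ) = 0) :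
    IsWeakSolution ℓ ω α F D r c := by
  refine (isWeakSolution_iff_boundary hℓ hD).2 fun f f' c' hf _ => ?_
  rw [← map_sum, h_vertex, map_mul, Complex.conj_ofReal, sub_self, zero_mul, zero_add]
  refine Finset.sum_eq_zero fun j _ => ?_
  rcases eq_or_ne (ℓ j) ⊤ with h_top | h_top
  · rw [if_pos h_top, endCoeff, if_pos h_top, Complex.ofReal_zero, zero_mul, add_zero, zero_mul]
  have h_eq := (EReal.coe_toReal h_top (hℓ j).ne_bot).symm
  by_cases hω : Real.sin (ω j) = 0
  · rw [(hf j).eq_zero_of_sin_eq_zero _ h_eq hω, mul_zero]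
  have hω' : (Real.sin (ω j) : ℂ) ≠ 0 := Complex.ofReal_ne_zero.2 hω
  have h_conj := congrArg (starRingEnd ℂ) (h_end j _ h_eq)
  simp only [map_add, map_mul, Complex.conj_ofReal, map_zero] at h_conj
  rw [if_neg h_top, endCoeff, if_neg h_top, Complex.ofReal_div, mul_eq_zero]
  left
  field_simp
  linear_combination h_conj

end StrongSolution

section WeakEquation

open scoped InnerProductSpace

variable {N : ℕ} {ℓ : Fin N → EReal} {ω : Fin N → ℝ} {V U : Fin N → ℝ → ℝ} {m s κ α : ℝ}

theorem inner_stateSpace (g h : StateSpace ℓ) :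
    ⟪g, h⟫_ℂ = ∑ j, ∫ x, starRingEnd ℂ (g j x) * h j x ∂linkMeasure (ℓ j) := by
  simp only [PiLp.inner_apply, inner_Lp_eq_integral]

theorem isWeakSolution_of_inner (hℓ : ∀ j, 0 < ℓ j)
    (hV : ∀ j, LocallyIntegrableOn (V j) (closedLink (ℓ j)) volume)
    (hm : ∀ j, ∀ᵐ x ∂linkMeasure (ℓ j), m ≤ V j x)
    (hκ : TraceBound ℓ ω (formWeight V m) s κ) (hs : s ≠ 0)
    (hU : ∀ j, Integrable (U j) (linkMeasure (ℓ j)))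
    {p : FormDomain ℓ ω (formWeight V m) s} {g : StateSpace ℓ}
    (hp : ∀ q : FormDomain ℓ ω (formWeight V m) s, ⟪p, q⟫_ℂ +
      ⟪couplingOperator ℓ ω (formWeight V m) s α U (fun j => endCoeff (ℓ j) (ω j)) p, q⟫_ℂ =
        ⟪g, formInclusion ℓ ω (formWeight V m) s q⟫_ℂ) :
    IsWeakSolution ℓ ω α (fun j x => evalAt j x p.1) (fun j => derivPart j p.1)
      (fun j x => ((V j x + U j x - m + s ^ 2 : ℝ) : ℂ) * evalAt j x p.1 - g j x)
      (vertex p.1) := by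
  intro f f' c' hf hc
  obtain ⟨q, hq_vertex, hq_deriv, hq_eval⟩ := exists_mem_formDomain (w := formWeight V m) (s := s)
    hℓ (fun j => (hf j).hasLocACDeriv) hc (fun j => (hf j).memLp_deriv)
    (fun j => (hf j).memLp_sqrt_mul (hV j) m) (fun j => (hf j).memLp)
    (fun j => (hf j).eq_zero_of_sin_eq_zero)
  have hpq := hp q
  rw [inner_add_inner_couplingOperator hm hκ hU, inner_stateSpace, ← sub_eq_zero, add_sub_assoc,
    ← Finset.sum_sub_distrib, hq_vertex] at hpq
  rw [← hpq]
  congr 1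
  refine Finset.sum_congr rfl fun j _ => ?_
  rw [add_sub_right_comm, ← integral_sub (integrable_energyDensity_add hm hκ (hU j) p q)
    (integrable_conj_mul_Lp _ _), hq_eval j _ (toReal_mem_closedLink (hℓ j))]
  congr 1
  refine integral_congr_ae ?_
  filter_upwards [hq_deriv j, formInclusion_ae_eq hs q j,
    ae_restrict_mem (measurableSet_link (ℓ j))] with x hx_deriv hx_incl hx
  simp only [energyDensity, hx_deriv, hx_incl, hq_eval j x (link_subset_closedLink hx), map_sub,
    map_mul, Complex.conj_ofReal]
  ring

theorem intervalIntegrable_potential_mul_sub {ℓ : EReal} {V U : ℝ → ℝ}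
    (hV : LocallyIntegrableOn V (closedLink ℓ) volume) (hU : Integrable U (linkMeasure ℓ))
    {F p : ℝ → ℂ} (hF : HasLocACDeriv ℓ F p) (g : Lp ℂ 2 (linkMeasure ℓ)) (k : ℝ) {x : ℝ}
    (hx : x ∈ closedLink ℓ) :
    IntervalIntegrable (fun t => ((V t + U t - k : ℝ) : ℂ) * F t - g t) volume 0 x := by
  have hV' : IntervalIntegrable V volume 0 x :=
    (intervalIntegrable_iff_integrableOn_Icc_of_le hx.1).2
      (hV.integrableOn_compact_subset (Icc_subset_closedLink hx) isCompact_Icc)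
  have hU' : IntervalIntegrable U volume 0 x :=
    (intervalIntegrable_iff_integrableOn_linkMeasure hx).2 hU.integrableOn
  have hVU : IntervalIntegrable (fun t => V t + U t - k) volume 0 x :=
    (hV'.add hU').sub intervalIntegrable_const
  have hVU' : IntervalIntegrable (fun t => ((V t + U t - k : ℝ) : ℂ)) volume 0 x :=
    ⟨hVU.1.ofReal, hVU.2.ofReal⟩
  exact (hVU'.mul_continuousOn (by simpa only [uIcc_of_le hx.1] using hF.continuousOn_Icc hx)).sub
    ((intervalIntegrable_iff_integrableOn_linkMeasure hx).2 (integrableOn_Ioc_Lp g 0 x))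

theorem mem_hamiltonianGraph_of_inner (hℓ : ∀ j, 0 < ℓ j)
    (hV : ∀ j, LocallyIntegrableOn (V j) (closedLink (ℓ j)) volume)
    (hm : ∀ j, ∀ᵐ x ∂linkMeasure (ℓ j), m ≤ V j x)
    (hκ : TraceBound ℓ ω (formWeight V m) s κ) (hs : s ≠ 0)
    (hU : ∀ j, Integrable (U j) (linkMeasure (ℓ j)))
    {p : FormDomain ℓ ω (formWeight V m) s} {g : StateSpace ℓ}
    (hp : ∀ q : FormDomain ℓ ω (formWeight V m) s, ⟪p, q⟫_ℂ +
      ⟪couplingOperator ℓ ω (formWeight V m) s α U (fun j => endCoeff (ℓ j) (ω j)) p, q⟫_ℂ =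
        ⟪g, formInclusion ℓ ω (formWeight V m) s q⟫_ℂ) :
    (formInclusion ℓ ω (formWeight V m) s p,
      g + ((m - s ^ 2 : ℝ) : ℂ) • formInclusion ℓ ω (formWeight V m) s p) ∈
      hamiltonianGraph ℓ ω α (fun j => V j + U j) := by
  have h_weak := isWeakSolution_of_inner hℓ hV hm hκ hs hU hp
  have hF := fun j => hasLocACDeriv_evalAt j p.1
  choose D hD hbD using fun j => h_weak.exists_hasLocACDeriv hℓ (Lp.memLp (derivPart j p.1))
    fun x hx => by
      simpa only [sub_add] using
        intervalIntegrable_potential_mul_sub (hV j) (hU j) (hF j) (g j) (m - s ^ 2) hx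
  have h_strong := h_weak.congr_ae hbD
  refine ⟨_, D, _, formInclusion_ae_eq hs p, fun j => (hF j).congr_ae (hbD j), hD, fun j => ?_,
    ⟨vertex p.1, fun j => by rw [evalAt_zero], h_strong.vertex_condition hℓ hD⟩,
    fun j b hb => h_strong.end_condition hℓ (hD j) hb (evalAt_eq_zero_of_sin_eq_zero p hb)⟩
  set J := formInclusion ℓ ω (formWeight V m) s p
  filter_upwards [Lp.coeFn_add (g j) (((m - s ^ 2 : ℝ) : ℂ) • J j),
    Lp.coeFn_smul ((m - s ^ 2 : ℝ) : ℂ) (J j), formInclusion_ae_eq hs p j] with x h_add h_smul hJ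
  rw [PiLp.add_apply, PiLp.smul_apply, h_add, Pi.add_apply, h_smul, Pi.smul_apply, hJ]
  simp only [Pi.add_apply, smul_eq_mul]
  push_cast
  ring

end WeakEquation

section Localization

open scoped InnerProductSpace

theorem one_sub_norm_mul_sq_norm_le {Q : Type*} [NormedAddCommGroup Q] [InnerProductSpace ℂ Q]
    (T : Q →L[ℂ] Q) (q : Q) : (1 - ‖T‖) * ‖q‖ ^ 2 ≤ (⟪q, q⟫_ℂ + ⟪T q, q⟫_ℂ).re := by
  have h_inner : ‖⟪T q, q⟫_ℂ‖ ≤ ‖T‖ * ‖q‖ ^ 2 := by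
    rw [sq, ← mul_assoc]
    exact (norm_inner_le_norm _ _).trans (by gcongr; exact T.le_opNorm q)
  have h_re := neg_le_of_abs_le ((Complex.abs_re_le_norm ⟪T q, q⟫_ℂ).trans h_inner)
  have h_self : (⟪q, q⟫_ℂ).re = ‖q‖ ^ 2 := inner_self_eq_norm_sq (𝕜 := ℂ) q
  rw [Complex.add_re, h_self]
  linarith

theorem re_energy_mul_eq (v χ χ' : ℝ) (z z' : ℂ) :
    (starRingEnd ℂ (χ' * z + χ * z') * (χ' * z + χ * z') +
      v * (starRingEnd ℂ (χ * z) * (χ * z))).re =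
      χ' ^ 2 * ‖z‖ ^ 2 + (starRingEnd ℂ z' * (χ' * (χ * z) + χ * (χ' * z + χ * z')) +
        starRingEnd ℂ (v * z) * (χ * (χ * z))).re := by
  simp only [← Complex.normSq_eq_norm_sq, Complex.normSq_apply, map_add, map_mul,
    Complex.conj_ofReal, Complex.add_re, Complex.mul_re, Complex.mul_im, Complex.add_im,
    Complex.conj_re, Complex.conj_im, Complex.ofReal_re, Complex.ofReal_im]
  ring

variable {N : ℕ} {ℓ : Fin N → EReal} {ω : Fin N → ℝ} {V U : Fin N → ℝ → ℝ} {m s κ α : ℝ}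
  {F D r : Fin N → ℝ → ℂ} {χ χ' : ℝ → ℝ} {c : ℂ}

theorem re_integral_energyDensity_mul_eq {j : Fin N} {v : ℝ → ℝ} {p : FormSpace ℓ}
    (hp_int : Integrable (energyDensity v p p j) (linkMeasure (ℓ j)))
    (hp_deriv : derivPart j p =ᵐ[linkMeasure (ℓ j)] fun x => χ' x * F j x + χ x * D j x)
    (hp_eval : ∀ x ∈ closedLink (ℓ j), evalAt j x p = χ x * F j x)
    (hr : r j =ᵐ[linkMeasure (ℓ j)] fun x => v x * F j x)
    (hr_int : Integrable (fun x => starRingEnd ℂ (D j x) *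
      (χ' x * (χ x * F j x) + χ x * (χ' x * F j x + χ x * D j x)) +
        starRingEnd ℂ (r j x) * (χ x * (χ x * F j x))) (linkMeasure (ℓ j))) :
    (∫ x, energyDensity v p p j x ∂linkMeasure (ℓ j)).re =
      ∫ x, χ' x ^ 2 * ‖F j x‖ ^ 2 ∂linkMeasure (ℓ j) +
        (∫ x, (starRingEnd ℂ (D j x) *
          (χ' x * (χ x * F j x) + χ x * (χ' x * F j x + χ x * D j x)) +
            starRingEnd ℂ (r j x) * (χ x * (χ x * F j x))) ∂linkMeasure (ℓ j)).re := by
  rw [← sub_eq_iff_eq_add, ← Complex.sub_re, ← integral_sub hp_int hr_int]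
  refine (Complex.reCLM.integral_comp_comm (hp_int.sub hr_int)).symm.trans (integral_congr_ae ?_)
  filter_upwards [hp_deriv, hr, ae_restrict_mem (measurableSet_link (ℓ j))] with x h_deriv hrx hx
  rw [Complex.reCLM_apply, Pi.sub_apply, Complex.sub_re, sub_eq_iff_eq_add, energyDensity, h_deriv,
    hrx, hp_eval x (link_subset_closedLink hx), re_energy_mul_eq]

/- The IMS localization formula: since `ψ` is a weak solution, testing its equation with `χ² ψ`
leaves only `∫ |χ'|² |ψ|²` of the energy of `χ ψ`. -/
theorem re_inner_add_inner_couplingOperator_eq (hℓ : ∀ j, 0 < ℓ j)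
    (hm : ∀ j, ∀ᵐ x ∂linkMeasure (ℓ j), m ≤ V j x)
    (hκ : TraceBound ℓ ω (formWeight V m) s κ)
    (hU : ∀ j, Integrable (U j) (linkMeasure (ℓ j)))
    (h_weak : IsWeakSolution ℓ ω α F D r c) (hD : ∀ j, HasLocACDeriv (ℓ j) (D j) (r j))
    (hr : ∀ j, r j =ᵐ[linkMeasure (ℓ j)] fun x => (V j x + U j x - m + s ^ 2 : ℝ) * F j x)
    (hF : ∀ j, F j 0 = c) (hχ : χ 0 = 1)
    (h_test : ∀ j, IsTestFunction (ℓ j) (ω j) (fun x => χ x * (χ x * F j x))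
      (fun x => χ' x * (χ x * F j x) + χ x * (χ' x * F j x + χ x * D j x)))
    {q : FormDomain ℓ ω (formWeight V m) s} (hq : vertex q.1 = c)
    (hq_deriv : ∀ j, derivPart j q.1 =ᵐ[linkMeasure (ℓ j)] fun x => χ' x * F j x + χ x * D j x)
    (hq_eval : ∀ j, ∀ x ∈ closedLink (ℓ j), evalAt j x q.1 = χ x * F j x) :
    (⟪q, q⟫_ℂ + ⟪couplingOperator ℓ ω (formWeight V m) s α U
        (fun j => endCoeff (ℓ j) (ω j)) q, q⟫_ℂ).re =
      ∑ j, ∫ x, χ' x ^ 2 * ‖F j x‖ ^ 2 ∂linkMeasure (ℓ j) := by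
  have h_zero := congrArg Complex.re (h_weak _ _ c h_test fun j => by simp [hχ, hF])
  rw [inner_add_inner_couplingOperator hm hκ hU, hq, ← sub_zero (Complex.re _), ← Complex.zero_re,
    ← h_zero, Complex.add_re, Complex.add_re, add_sub_add_left_eq_sub, Complex.re_sum,
    Complex.re_sum, ← Finset.sum_sub_distrib]
  refine Finset.sum_congr rfl fun j _ => ?_
  rw [Complex.add_re, Complex.add_re, re_integral_energyDensity_mul_eq
    (integrable_energyDensity_add hm hκ (hU j) q q) (hq_deriv j) (hq_eval j) (hr j)
    ((h_test j).integral_conj_mul (hℓ j) (hD j)).1, hq_eval j _ (toReal_mem_closedLink (hℓ j)),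
    map_mul, Complex.conj_ofReal]
  ring_nf

theorem exists_evalAt_eq_cutoff_mul (hℓ : ∀ j, 0 < ℓ j)
    (hV : ∀ j, LocallyIntegrableOn (V j) (closedLink (ℓ j)) volume)
    (hm : ∀ j, ∀ᵐ x ∂linkMeasure (ℓ j), m ≤ V j x)
    (hκ : TraceBound ℓ ω (formWeight V m) s κ)
    (hU : ∀ j, Integrable (U j) (linkMeasure (ℓ j)))
    (h_weak : IsWeakSolution ℓ ω α F D r c) (hFD : ∀ j, HasLocACDeriv (ℓ j) (F j) (D j))
    (hD : ∀ j, HasLocACDeriv (ℓ j) (D j) (r j))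
    (hr : ∀ j, r j =ᵐ[linkMeasure (ℓ j)] fun x => (V j x + U j x - m + s ^ 2 : ℝ) * F j x)
    (hF : ∀ j, F j 0 = c) (hF_end : ∀ j, ∀ b : ℝ, ℓ j = b → Real.sin (ω j) = 0 → F j b = 0)
    (hF_memLp : ∀ j, MemLp (F j) 2 (linkMeasure (ℓ j))) {a : ℝ} (ha : 0 < a) :
    ∃ q : FormDomain ℓ ω (formWeight V m) s,
      (∀ j, ∀ x ∈ closedLink (ℓ j), evalAt j x q.1 = cutoff a x * F j x) ∧
      (1 - ‖couplingOperator ℓ ω (formWeight V m) s α U (fun j => endCoeff (ℓ j) (ω j))‖) *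
        ‖q‖ ^ 2 ≤ (a ^ 2)⁻¹ * ∑ j, ∫ x, ‖F j x‖ ^ 2 ∂linkMeasure (ℓ j) := by
  have h_test : ∀ j, IsTestFunction (ℓ j) (ω j) (fun x => cutoff a x * F j x)
      (fun x => cutoffDeriv a x * F j x + cutoff a x * D j x) := fun j =>
    isTestFunction_cutoff_mul (hℓ j) ha (hFD j) (fun x hx => (hD j).memLp_restrict_Ioc hx)
      fun b hb hω => by rw [hF_end j b hb hω, mul_zero]
  have h_test_sq : ∀ j, IsTestFunction (ℓ j) (ω j) (fun x => cutoff a x * (cutoff a x * F j x))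
      (fun x => cutoffDeriv a x * (cutoff a x * F j x) +
        cutoff a x * (cutoffDeriv a x * F j x + cutoff a x * D j x)) := fun j =>
    isTestFunction_cutoff_mul (hℓ j) ha (h_test j).hasLocACDeriv
      (fun x _ => (h_test j).memLp_deriv.restrict _)
      fun b hb hω => by rw [hF_end j b hb hω, mul_zero, mul_zero]
  obtain ⟨q, hq, hq_deriv, hq_eval⟩ := exists_mem_formDomain (ω := ω) (w := formWeight V m)
    (s := s) hℓ (fun j => (h_test j).hasLocACDeriv)
    (fun j => by rw [cutoff_zero, Complex.ofReal_one, one_mul, hF j])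
    (fun j => (h_test j).memLp_deriv) (fun j => (h_test j).memLp_sqrt_mul (hV j) m)
    (fun j => (h_test j).memLp) (fun j => (h_test j).eq_zero_of_sin_eq_zero)
  refine ⟨q, hq_eval, (one_sub_norm_mul_sq_norm_le _ q).trans ?_⟩
  rw [re_inner_add_inner_couplingOperator_eq hℓ hm hκ hU h_weak hD hr hF (cutoff_zero a) h_test_sq
    hq hq_deriv hq_eval, Finset.mul_sum]
  refine Finset.sum_le_sum fun j _ => ?_
  rw [← integral_const_mul]
  refine integral_mono_of_nonneg (.of_forall fun x => by positivity)
    (((hF_memLp j).integrable_norm_pow two_ne_zero).const_mul _) (.of_forall fun x => ?_)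
  exact mul_le_mul_of_nonneg_right (sq_cutoffDeriv_le a x) (by positivity)

theorem IsWeakSolution.eq_zero (hℓ : ∀ j, 0 < ℓ j)
    (hV : ∀ j, LocallyIntegrableOn (V j) (closedLink (ℓ j)) volume)
    (hm : ∀ j, ∀ᵐ x ∂linkMeasure (ℓ j), m ≤ V j x)
    (hκ : TraceBound ℓ ω (formWeight V m) s κ)
    (hU : ∀ j, Integrable (U j) (linkMeasure (ℓ j)))
    (hT : ‖couplingOperator ℓ ω (formWeight V m) s α U (fun j => endCoeff (ℓ j) (ω j))‖ < 1)
    (h_weak : IsWeakSolution ℓ ω α F D r c) (hFD : ∀ j, HasLocACDeriv (ℓ j) (F j) (D j))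
    (hD : ∀ j, HasLocACDeriv (ℓ j) (D j) (r j))
    (hr : ∀ j, r j =ᵐ[linkMeasure (ℓ j)] fun x => (V j x + U j x - m + s ^ 2 : ℝ) * F j x)
    (hF : ∀ j, F j 0 = c) (hF_end : ∀ j, ∀ b : ℝ, ℓ j = b → Real.sin (ω j) = 0 → F j b = 0)
    (hF_memLp : ∀ j, MemLp (F j) 2 (linkMeasure (ℓ j))) {j : Fin N} {x : ℝ}
    (hx : x ∈ closedLink (ℓ j)) : F j x = 0 := by
  set S := ∑ j, ∫ x, ‖F j x‖ ^ 2 ∂linkMeasure (ℓ j)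
  set δ := 1 - ‖couplingOperator ℓ ω (formWeight V m) s α U (fun j => endCoeff (ℓ j) (ω j))‖
  have hδ : 0 < δ := sub_pos.2 hT
  have h_le : ∀ᶠ a : ℝ in atTop, δ * ‖F j x‖ ^ 2 ≤ κ ^ 2 * ((a ^ 2)⁻¹ * S) := by
    filter_upwards [eventually_gt_atTop 0, eventually_ge_atTop x] with a ha hxa
    obtain ⟨q, hq_eval, hq_norm⟩ := exists_evalAt_eq_cutoff_mul hℓ hV hm hκ hU h_weak hFD hD hr hF
      hF_end hF_memLp ha
    have h_eval : F j x = formEval ℓ ω (formWeight V m) s j x q := by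
      change F j x = evalAt j x q.1
      rw [hq_eval j x hx, cutoff_of_le hx.1 ha hxa, Complex.ofReal_one, one_mul]
    calc δ * ‖F j x‖ ^ 2 ≤ δ * (κ * ‖q‖) ^ 2 := by
          rw [h_eval]
          gcongr
          exact (formEval ℓ ω _ s j x).le_of_opNorm_le (hκ j x hx) q
      _ = κ ^ 2 * (δ * ‖q‖ ^ 2) := by ring
      _ ≤ κ ^ 2 * ((a ^ 2)⁻¹ * S) := by gcongr
  have h_lim : Tendsto (fun a : ℝ => κ ^ 2 * ((a ^ 2)⁻¹ * S)) atTop (𝓝 0) := by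
    have h_inv : Tendsto (fun a : ℝ => (a ^ 2)⁻¹) atTop (𝓝 0) :=
      (tendsto_pow_atTop two_ne_zero).inv_tendsto_atTop
    simpa only [zero_mul, mul_zero] using (h_inv.mul_const S).const_mul (κ ^ 2)
  have h_nonpos := nonpos_of_mul_nonpos_right (ge_of_tendsto h_lim h_le) hδ
  exact norm_eq_zero.1 (pow_eq_zero_iff two_ne_zero |>.1 (h_nonpos.antisymm (sq_nonneg _)))

theorem eq_zero_of_mul_cos_add_mul_sin_eq_zero {θ : ℝ} {z z' : ℂ}
    (h : z * (Real.cos θ : ℂ) + z' * (Real.sin θ : ℂ) = 0) (hθ : Real.sin θ = 0) : z = 0 := by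
  have h_cos : Real.cos θ ≠ 0 := fun h_cos => by
    simpa only [hθ, h_cos, zero_pow two_ne_zero, add_zero, zero_ne_one] using
      Real.sin_sq_add_cos_sq θ
  rw [hθ, Complex.ofReal_zero, mul_zero, add_zero, mul_eq_zero] at h
  exact h.resolve_right (Complex.ofReal_ne_zero.2 h_cos)

theorem eq_zero_of_mem_hamiltonianGraph (hℓ : ∀ j, 0 < ℓ j)
    (hV : ∀ j, LocallyIntegrableOn (V j) (closedLink (ℓ j)) volume)
    (hm : ∀ j, ∀ᵐ x ∂linkMeasure (ℓ j), m ≤ V j x)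
    (hκ : TraceBound ℓ ω (formWeight V m) s κ)
    (hU : ∀ j, Integrable (U j) (linkMeasure (ℓ j)))
    (hT : ‖couplingOperator ℓ ω (formWeight V m) s α U (fun j => endCoeff (ℓ j) (ω j))‖ < 1)
    {ψ : StateSpace ℓ} (hψ : (ψ, ((m - s ^ 2 : ℝ) : ℂ) • ψ) ∈
      hamiltonianGraph ℓ ω α (fun j => V j + U j)) : ψ = 0 := by
  obtain ⟨F, D, r, hψF, hFD, hD, hψr, ⟨c, hF, h_vertex⟩, h_end⟩ := hψ
  have hr : ∀ j, r j =ᵐ[linkMeasure (ℓ j)]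
      fun x => (V j x + U j x - m + s ^ 2 : ℝ) * F j x := fun j => by
    filter_upwards [hψF j, hψr j, Lp.coeFn_smul ((m - s ^ 2 : ℝ) : ℂ) (ψ j)] with x hFx hrx h_smul
    rw [PiLp.smul_apply, h_smul, Pi.smul_apply, hFx, smul_eq_mul, Pi.add_apply] at hrx
    push_cast at hrx ⊢
    linear_combination hrx
  ext j : 1
  refine Lp.ext ?_
  filter_upwards [hψF j, Lp.coeFn_zero ℂ 2 (linkMeasure (ℓ j)),
    ae_restrict_mem (measurableSet_link (ℓ j))] with x hFx h_zero hx
  have h_weak := isWeakSolution_of_boundary_conditions hℓ hD h_vertex h_end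
  rw [hFx, h_weak.eq_zero hℓ hV hm hκ hU hT hFD hD hr hF
    (fun j b hb hω => eq_zero_of_mul_cos_add_mul_sin_eq_zero (h_end j b hb) hω)
    (fun j => (memLp_congr_ae (hψF j)).1 (Lp.memLp _)) (link_subset_closedLink hx)]
  exact h_zero.symm

end Localization

section Resolvent

variable {N : ℕ} {ℓ : Fin N → EReal} {ω : Fin N → ℝ} {V U : Fin N → ℝ → ℝ} {m s κ α : ℝ}

theorem isResolventAt_formResolvent (hℓ : ∀ j, 0 < ℓ j)
    (hV : ∀ j, LocallyIntegrableOn (V j) (closedLink (ℓ j)) volume)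
    (hm : ∀ j, ∀ᵐ x ∂linkMeasure (ℓ j), m ≤ V j x)
    (hκ : TraceBound ℓ ω (formWeight V m) s κ) (hs : s ≠ 0)
    (hU : ∀ j, Integrable (U j) (linkMeasure (ℓ j)))
    (hT : ‖couplingOperator ℓ ω (formWeight V m) s α U (fun j => endCoeff (ℓ j) (ω j))‖ < 1) :
    IsResolventAt (hamiltonian ℓ ω α (fun j => V j + U j)) ((m - s ^ 2 : ℝ) : ℂ)
      (formResolvent (formInclusion ℓ ω (formWeight V m) s)
        (couplingOperator ℓ ω (formWeight V m) s α U (fun j => endCoeff (ℓ j) (ω j)))) := by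
  set H := hamiltonian ℓ ω α (fun j => V j + U j)
  set R := formResolvent (formInclusion ℓ ω (formWeight V m) s)
    (couplingOperator ℓ ω (formWeight V m) s α U (fun j => endCoeff (ℓ j) (ω j)))
  have h_surj : ∀ g, ∃ x : H.domain,
      (x : StateSpace ℓ) = R g ∧ H x - ((m - s ^ 2 : ℝ) : ℂ) • (x : StateSpace ℓ) = g := by
    intro g
    obtain ⟨p, hpR, hp⟩ := exists_inner_add_inner_eq_inner _ hT g
    have h_mem := mem_hamiltonianGraph_of_inner hℓ hV hm hκ hs hU hp
    rw [← graph_hamiltonian, LinearPMap.mem_graph_iff] at h_mem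
    obtain ⟨x, hxp, hHx⟩ := h_mem
    exact ⟨x, hxp.trans hpR, by rw [hHx, hxp, add_sub_cancel_right]⟩
  refine ⟨h_surj, fun x => ?_⟩
  obtain ⟨y, hyR, hHy⟩ := h_surj (H x - ((m - s ^ 2 : ℝ) : ℂ) • (x : StateSpace ℓ))
  rw [← hyR, ← sub_eq_zero]
  refine eq_zero_of_mem_hamiltonianGraph hℓ hV hm hκ hU hT ?_
  rw [← graph_hamiltonian, LinearPMap.mem_graph_iff]
  refine ⟨y - x, rfl, ?_⟩
  rw [LinearPMap.map_sub, smul_sub]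
  exact sub_eq_sub_iff_sub_eq_sub.1 hHy

end Resolvent

section Constants

variable {N : ℕ} {ℓ : Fin N → EReal} {ω : Fin N → ℝ} {w : Fin N → ℝ → ℝ} {s κ : ℝ}
  {W : Fin N → ℝ → ℝ} {θ : Fin N → ℝ}

theorem exists_forall_ae_le {ι X : Type*} [Finite ι] [MeasurableSpace X] {μ : ι → Measure X}
    {V : ι → X → ℝ} (h : ∀ i, ∃ m : ℝ, ∀ᵐ x ∂μ i, m ≤ V i x) :
    ∃ m : ℝ, ∀ i, ∀ᵐ x ∂μ i, m ≤ V i x := by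
  choose m hm using h
  obtain ⟨M, hM⟩ := (finite_range m).bddBelow
  exact ⟨M, fun i => (hm i).mono fun _ => (hM (mem_range_self i)).trans⟩

theorem exists_traceBound_mul_sq_lt_one (hℓ : ∀ j, 0 < ℓ j) (ω : Fin N → ℝ) (w : Fin N → ℝ → ℝ)
    (C : ℝ) : ∃ s κ : ℝ, s ≠ 0 ∧ TraceBound ℓ ω w s κ ∧ C * κ ^ 2 < 1 := by
  have h_small : ∀ᶠ L : ℝ in 𝓝[>] 0, C * (2 * L) < 1 := by
    have h_cont : Continuous fun L : ℝ => C * (2 * L) := by fun_prop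
    refine nhdsWithin_le_nhds ((h_cont.tendsto 0).eventually_lt_const ?_)
    rw [mul_zero, mul_zero]
    exact zero_lt_one
  have h_short : ∀ᶠ L : ℝ in 𝓝[>] 0, ∀ j, (L : EReal) < ℓ j := eventually_all.2 fun j =>
    nhdsWithin_le_nhds ((continuous_coe_real_ereal.tendsto 0).eventually_lt_const (hℓ j))
  have h_pos : ∀ᶠ L : ℝ in 𝓝[>] 0, 0 < L := self_mem_nhdsWithin
  obtain ⟨L, hL, hLC, hLℓ⟩ := (h_pos.and (h_small.and h_short)).exists
  refine ⟨L⁻¹, √(2 * L), inv_ne_zero hL.ne',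
    traceBound_sqrt (inv_mul_cancel₀ hL.ne') hL fun j => (hLℓ j).le, ?_⟩
  rwa [Real.sq_sqrt (by positivity)]

theorem norm_couplingOperator_lt_one_of_eq_sum (hN : 0 < N) (hℓ : ∀ j, 0 < ℓ j)
    (hκ : TraceBound ℓ ω w s κ)
    (hC : (1 + ∑ j, (∫ x, |W j x| ∂linkMeasure (ℓ j) + |θ j|)) * κ ^ 2 < 1) :
    ‖couplingOperator ℓ ω w s (∑ j, ∫ x, W j x ∂linkMeasure (ℓ j)) 0 θ‖ < 1 := by
  have h_abs : |∑ j, ∫ x, W j x ∂linkMeasure (ℓ j)| ≤ ∑ j, ∫ x, |W j x| ∂linkMeasure (ℓ j) :=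
    (Finset.abs_sum_le_sum_abs _ _).trans
      (Finset.sum_le_sum fun _ _ => abs_integral_le_integral_abs)
  refine (norm_couplingOperator_le hN hℓ hκ fun j => integrable_zero ℝ ℝ _).trans_lt
    (hC.trans_le' ?_)
  gcongr ?_ * _
  simp only [Pi.zero_apply, abs_zero, integral_zero, zero_add, Finset.sum_add_distrib]
  linarith [abs_sub (∑ j, ∫ x, W j x ∂linkMeasure (ℓ j)) 1, abs_one (α := ℝ)]

theorem norm_couplingOperator_squeezed_lt_one (hN : 0 < N) (hℓ : ∀ j, 0 < ℓ j)
    (hκ : TraceBound ℓ ω w s κ) (hW : ∀ j, Integrable (W j) (linkMeasure (ℓ j)))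
    (hC : (1 + ∑ j, (∫ x, |W j x| ∂linkMeasure (ℓ j) + |θ j|)) * κ ^ 2 < 1) {ε : ℝ} (hε : 0 < ε)
    (hε1 : ε ≤ 1) :
    ‖couplingOperator ℓ ω w s 0 (fun j => squeezed (ℓ j) ε (W j)) θ‖ < 1 := by
  refine (norm_couplingOperator_le hN hℓ hκ fun j => integrable_squeezed hε.ne' (hW j)).trans_lt ?_
  simpa only [integral_abs_squeezed hε hε1, zero_sub, abs_neg, abs_one] using hC

end Constants

end

end StarGraph

theorem mainTheorem2 {N : ℕ} (hN : 2 ≤ N)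
    (ℓ : Fin N → EReal) (hℓ : ∀ j, 0 < ℓ j) (ω : Fin N → ℝ)
    (V W : Fin N → ℝ → ℝ)
    (hV : ∀ j, LocallyIntegrableOn (V j) (StarGraph.closedLink (ℓ j)) volume)
    (hVbdd : ∀ j, ∃ m : ℝ, ∀ᵐ x ∂StarGraph.linkMeasure (ℓ j), m ≤ V j x)
    (hW : ∀ j, Integrable (W j) (StarGraph.linkMeasure (ℓ j))) :
    StarGraph.NormResolventTendsto
      (fun ε : ℝ => StarGraph.hamiltonian ℓ ω 0
        (fun j => V j + StarGraph.squeezed (ℓ j) ε (W j)))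
      (𝓝[>] 0)
      (StarGraph.hamiltonian ℓ ω (∑ j, ∫ x, W j x ∂StarGraph.linkMeasure (ℓ j)) V) := by
  have hN_pos : 0 < N := zero_lt_two.trans_le hN
  obtain ⟨m, hm⟩ := StarGraph.exists_forall_ae_le hVbdd
  let θ : Fin N → ℝ := fun j => StarGraph.endCoeff (ℓ j) (ω j)
  obtain ⟨s, κ, hs, hκ, hC⟩ := StarGraph.exists_traceBound_mul_sq_lt_one hℓ ω
    (StarGraph.formWeight V m)
    (1 + ∑ j, (∫ x, |W j x| ∂StarGraph.linkMeasure (ℓ j) + |θ j|))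
  have h_limit := StarGraph.norm_couplingOperator_lt_one_of_eq_sum hN_pos hℓ hκ hC
  have h_resolvent := StarGraph.isResolventAt_formResolvent hℓ hV hm hκ hs
    (fun j => integrable_zero ℝ ℝ (StarGraph.linkMeasure (ℓ j))) h_limit
  simp only [add_zero] at h_resolvent
  refine StarGraph.normResolventTendsto_of_formResolvent (StarGraph.formInclusion ℓ ω _ s)
    (.of_forall fun ε => StarGraph.isSelfAdjoint_couplingOperator) ?_
    StarGraph.isSelfAdjoint_couplingOperator h_resolvent h_limit
    (StarGraph.tendsto_couplingOperator_squeezed hκ hW θ)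
  filter_upwards [Ioc_mem_nhdsGT zero_lt_one] with ε ⟨hε, hε1⟩
  exact StarGraph.isResolventAt_formResolvent hℓ hV hm hκ hs
    (fun j => StarGraph.integrable_squeezed hε.ne' (hW j))
    (StarGraph.norm_couplingOperator_squeezed_lt_one hN_pos hℓ hκ hW hC hε hε1)
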